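/- Let $(M,g)$ be a smooth, time-oriented Lorentzian manifold (signature $(-,+,\dots,+)$; Hausdorff, second countable, finite-dimensional), possibly with boundary, in which case the boundary is assumed to be a timelike hypersurface. A \emph{causal curve} is a piecewise $C^1$ curve, defined on an interval and with locally finitely many break points, whose (one-sided) velocities are nonzero, timelike or null, and future-directed. $J^+(p)$ is the set consisting of $p$ and of all points that can be reached from $p$ along a causal curve, and $J^-(q)=\{p : q\in J^+(p)\}$. A causal curve is \emph{inextendible} if it has neither a future nor a past endpoint in $M$. A set is \emph{acausal} if no two distinct points of it are connected by a causal curve. A \emph{Cauchy slice} is a closed acausal set $\Sigma\subset M$ whose domain of dependence is all of $M$, i.e. every inextendible causal curve intersects $\Sigma$. Suppose that $(M,g)$ is globally hyperbolic: it is strongly causal (every neighbourhood $U$ of a point contains a neighbourhood $V$ of that point such that each causal curve with both ends in $V$ stays in $U$), and $J^+(p)\cap J^-(q)$ is compact for all $p,q\in M$. If $R\subset M$ is a compact acausal set, then there exists a Cauchy slice $\Sigma$ of $M$ with $R\subset\Sigma$. -/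

import Mathlib

open Set Filter Topology
open scoped Manifold ContDiff

noncomputable section

namespace CausalTheory

variable {E : Type*} [NormedAddCommGroup E] [NormedSpace ℝ E]
  {H : Type*} [TopologicalSpace H] {I : ModelWithCorners ℝ E H}
  {M : Type*} [TopologicalSpace M] [ChartedSpace H M] [IsManifold I ∞ M]

variable (I M) in
/-- A smooth time-oriented Lorentzian metric on the manifold `M` (which may have a boundary).
Signature `(-,+,…,+)`: at each point there is a vector of negative square (namely `timeDir x`) and
`metric x` is positive definite on the orthogonal complement of every vector of negative square.
The continuous timelike field `timeDir` fixes which causal vectors are future-directed. -/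
structure SpacetimeStructure where
  /-- The metric tensor. -/
  metric (x : M) : TangentSpace I x →L[ℝ] TangentSpace I x →L[ℝ] ℝ
  symm (x : M) (v w : TangentSpace I x) : metric x v w = metric x w v
  pos_of_orthogonal (x : M) (v w : TangentSpace I x) :
    metric x v v < 0 → metric x v w = 0 → w ≠ 0 → 0 < metric x w w
  contMDiff_metric : ContMDiff I (I.prod 𝓘(ℝ, E →L[ℝ] E →L[ℝ] ℝ)) ∞
    (fun x ↦ Bundle.TotalSpace.mk' (E →L[ℝ] E →L[ℝ] ℝ)
      (E := fun x : M ↦ TangentSpace I x →L[ℝ] TangentSpace I x →L[ℝ] ℝ) x (metric x))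
  /-- The time orientation. -/
  timeDir (x : M) : TangentSpace I x
  metric_timeDir_neg (x : M) : metric x (timeDir x) (timeDir x) < 0
  continuous_timeDir : Continuous (fun x ↦ (⟨x, timeDir x⟩ : TangentBundle I M))

namespace SpacetimeStructure

variable (g : SpacetimeStructure I M)

/-- When the model is the closed half-space `{y | 0 ≤ ℓ y}` of `E`, the vectors tangent to the
boundary of `M` at a boundary point are those with `ℓ v = 0` (a tangent vector at `x` is given by
its components in the preferred chart at `x`). The boundary is a timelike hypersurface if its
tangent hyperplane at each of its points contains a timelike vector, i.e. if the metric induced on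
it is Lorentzian. If the boundary is empty, this holds trivially. -/
def HasTimelikeBoundary (ℓ : E →L[ℝ] ℝ) : Prop :=
  ∀ x ∈ I.boundary M, ∃ v : E, ℓ v = 0 ∧ g.metric x (v : TangentSpace I x) v < 0

/-- `v` is a future-directed causal (nonzero, timelike or null) tangent vector at `x`. -/
def IsFutureCausal (x : M) (v : TangentSpace I x) : Prop :=
  v ≠ 0 ∧ g.metric x v v ≤ 0 ∧ g.metric x (g.timeDir x) v < 0

/-- On the compact interval `[s, t]`, with `s < t`, the curve `γ` is `C¹` (one-sidedly at the
ends) and its velocity is everywhere future-directed causal. -/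
def IsCausalArc (γ : ℝ → M) (s t : ℝ) : Prop :=
  ContMDiffOn 𝓘(ℝ) I 1 γ (Icc s t) ∧
    ∀ u ∈ Icc s t,
      g.IsFutureCausal (γ u) (mfderivWithin 𝓘(ℝ) I γ (Icc s t) u (1 : ℝ))

/-- `γ`, restricted to the interval `J`, is a future-directed, piecewise `C¹` causal curve: on each
compact subinterval `[a, b]` of `J` it consists of finitely many causal arcs, the break points
being contained in the finite set `F`. Values of `γ` outside `J` are irrelevant. -/
def IsCausalCurve (γ : ℝ → M) (J : Set ℝ) : Prop :=
  J.OrdConnected ∧ ∀ a ∈ J, ∀ b ∈ J, ∃ F : Set ℝ, F.Finite ∧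
    ∀ s t, a ≤ s → s < t → t ≤ b → Disjoint (Ioo s t) F → g.IsCausalArc γ s t

/-- The causal future `J⁺(p)`. -/
def causalFuture (p : M) : Set M :=
  {q | q = p ∨ ∃ (γ : ℝ → M) (a b : ℝ),
    a < b ∧ g.IsCausalCurve γ (Icc a b) ∧ γ a = p ∧ γ b = q}

/-- The causal past `J⁻(p)`. -/
def causalPast (p : M) : Set M :=
  {q | p ∈ g.causalFuture q}

/-- A set is acausal if no two points of it are connected by a causal curve. -/
def IsAcausal (S : Set M) : Prop :=
  ∀ p ∈ S, ∀ q ∈ S, q ∈ g.causalFuture p → p = q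

/-- Strong causality: each neighbourhood `U` of a point contains a neighbourhood `V` of it such that
every causal curve starting and ending in `V` stays in `U`. -/
def IsStronglyCausal : Prop :=
  ∀ x : M, ∀ U ∈ 𝓝 x, ∃ V ∈ 𝓝 x, V ⊆ U ∧
    ∀ (γ : ℝ → M) (a b : ℝ), g.IsCausalCurve γ (Icc a b) → γ a ∈ V → γ b ∈ V →
      γ '' Icc a b ⊆ U

/-- Global hyperbolicity: strong causality, and compactness of all causal diamonds. -/
def IsGloballyHyperbolic : Prop :=
  g.IsStronglyCausal ∧ ∀ p q : M, IsCompact (g.causalFuture p ∩ g.causalPast q)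

end SpacetimeStructure

/-- `x` is a future endpoint of the curve `γ` defined on the interval `J`. -/
def IsFutureEndpoint (γ : ℝ → M) (J : Set ℝ) (x : M) : Prop :=
  ∀ U ∈ 𝓝 x, ∃ t₀ ∈ J, ∀ t ∈ J, t₀ ≤ t → γ t ∈ U

/-- `x` is a past endpoint of the curve `γ` defined on the interval `J`. -/
def IsPastEndpoint (γ : ℝ → M) (J : Set ℝ) (x : M) : Prop :=
  ∀ U ∈ 𝓝 x, ∃ t₀ ∈ J, ∀ t ∈ J, t ≤ t₀ → γ t ∈ U

namespace SpacetimeStructure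

variable (g : SpacetimeStructure I M)

/-- An inextendible causal curve: a causal curve with neither a future nor a past endpoint. -/
def IsInextendibleCausalCurve (γ : ℝ → M) (J : Set ℝ) : Prop :=
  J.Nonempty ∧ g.IsCausalCurve γ J ∧
    (∀ x, ¬ IsFutureEndpoint γ J x) ∧ (∀ x, ¬ IsPastEndpoint γ J x)

/-- The domain of dependence `D[S]`: the set of points `p` such that every inextendible causal curve
through `p` intersects `S`. -/
def domainOfDependence (S : Set M) : Set M :=
  {p | ∀ (γ : ℝ → M) (J : Set ℝ), g.IsInextendibleCausalCurve γ J → p ∈ γ '' J →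
    (γ '' J ∩ S).Nonempty}

/-- An (acausal) Cauchy slice: a closed acausal set whose domain of dependence is the whole
spacetime. -/
def IsCauchySlice (S : Set M) : Prop :=
  IsClosed S ∧ g.IsAcausal S ∧ g.domainOfDependence S = univ

end SpacetimeStructure

end CausalTheory

end

/-!
The causal relation `q ∈ J⁺(p)` of a globally hyperbolic spacetime is a closed partial order, and
the causal future and past of an open set are open. From then on the argument is about ordered
topological spaces: a continuous strictly monotone function `f` is produced that vanishes on `R`,
is eventually positive towards the future and eventually negative towards the past of each
inextendible causal curve. Its zero set is the Cauchy slice: strict monotonicity makes it acausal,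
and the intermediate value theorem makes every inextendible causal curve meet it.

*Local geometry.* The only facts about the Lorentzian metric that are used are that it is Lipschitz
in charts and that at each point there is a timelike vector `v` along which one can move without
leaving the manifold: tangent to the boundary at boundary points, by the assumption on the boundary.
All points close to `x` are reached from `x - κ v` along straight lines
(`IsAdapted.exists_causalFuture_mem_nhdsWithin`), and a causal arc `γ` can be deformed into the
causal arc `γ - θ v`, with `θ > 0` as small as desired, if `θ` decreases exponentially, at a rate
given by the Lipschitz constant of the metric (`IsAdapted.exists_pushed_arc`). Together these
show that the causal future of an open set is open (`isOpen_causalFuture_of_isOpen`) without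
geodesics or convex neighbourhoods. Statements about the past follow by time reversal.

*Global geometry.* Compactness of the causal diamonds makes the order closed
(`isClosed_causal_relation`), and strong causality makes it antisymmetric and forces inextendible
causal curves to leave every compact set (`IsCausalCurve.eventually_notMem_future`).

*Time functions.* For a continuous `u ≥ 0` vanishing at infinity, `p ↦ sup {u x | x ≤ p}` is
continuous and monotone (`IsVanishing.continuous_supBelow`). Bump functions `u` give enough monotone
functions to separate points (`exists_monotone_separating`), and countably many of them sum to a
bounded strictly monotone `s` (`exists_strictMono`). For a positive `u`, let `α` and `β` be its
suprema over the past and the future of a point; since `β` tends to zero towards the future of an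
inextendible curve, and `α` towards its past, `log α - log β + s` is a Cauchy time function, which
is unbounded in both directions along such curves. On a compact antichain all continuous functions
are uniform limits of monotone ones, by the lattice form of the Stone-Weierstrass theorem; so they
extend to bounded monotone continuous functions on the whole space (`exists_monotone_extension`).
Adding such an extension of `-(log α - log β + s)` makes the time function vanish on `R`
(`exists_time_function`).
-/

namespace CausalTheory
noncomputable section

variable {E : Type*} [NormedAddCommGroup E] [NormedSpace ℝ E]
  {H : Type*} [TopologicalSpace H] {I : ModelWithCorners ℝ E H}
  {M : Type*} [TopologicalSpace M] [ChartedSpace H M] [IsManifold I ∞ M]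

namespace SpacetimeStructure

variable (g : SpacetimeStructure I M)

/-! ### The metric in a chart -/

variable (I) in
/-- The tangent vector at the point with coordinates `y`, in the chart at `x₀`, whose components in
this chart are the argument. -/
def chartVec (x₀ : M) (y : E) : E →L[ℝ] TangentSpace I ((extChartAt I x₀).symm y) :=
  mfderivWithin 𝓘(ℝ, E) I (extChartAt I x₀).symm (range I) y

/-- The matrix of the metric at `x`, in the trivialization of the tangent bundle at `x₀`. -/
def coordMetric (x₀ x : M) : E →L[ℝ] E →L[ℝ] ℝ :=
  ContinuousLinearMap.inCoordinates E (TangentSpace I) (E →L[ℝ] ℝ)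
    (fun x : M ↦ TangentSpace I x →L[ℝ] ℝ) x₀ x x₀ x (g.metric x)

/-- The matrix of the metric in the chart at `x₀`, as a function of the coordinates. -/
def chartMetric (x₀ : M) (y : E) : E →L[ℝ] E →L[ℝ] ℝ :=
  g.coordMetric x₀ ((extChartAt I x₀).symm y)

theorem coordMetric_apply {x₀ x : M} (hx : x ∈ (chartAt H x₀).source) (v w : E) :
    g.coordMetric x₀ x v w =
      g.metric x ((trivializationAt E (TangentSpace I) x₀).symmL ℝ x v)
        ((trivializationAt E (TangentSpace I) x₀).symmL ℝ x w) := by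
  unfold coordMetric
  erw [inCoordinates_apply_eq₂ (E₃ := Bundle.Trivial M ℝ) (by simpa using hx) (by simpa using hx)
    (by simp)]
  have hb : x ∈ (trivializationAt E (TangentSpace I) x₀).baseSet := by simpa using hx
  erw [Bundle.Trivial.linearMapAt_trivialization, Bundle.Trivialization.symmL_apply _ hb,
    Bundle.Trivialization.symmL_apply _ hb]
  rfl

/-- A tangent vector is given by its components in the preferred chart at its base point. -/
theorem symmL_self (x₀ : M) (v : E) :
    (trivializationAt E (TangentSpace I) x₀).symmL ℝ x₀ v = v := by
  rw [TangentBundle.symmL_trivializationAt_eq_core (mem_chart_source H x₀)]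
  exact (tangentBundleCore I M).coordChange_self _ _ (mem_chart_source H x₀) v

theorem coordMetric_self (x₀ : M) (v w : E) :
    g.coordMetric x₀ x₀ v w = g.metric x₀ (v : TangentSpace I x₀) (w : TangentSpace I x₀) := by
  rw [coordMetric_apply g (mem_chart_source H x₀), symmL_self, symmL_self]

omit [IsManifold I ∞ M] in
theorem mem_chart_source_of_mem_target {x₀ : M} {y : E} (hy : y ∈ (extChartAt I x₀).target) :
    (extChartAt I x₀).symm y ∈ (chartAt H x₀).source := by
  rw [← extChartAt_source I]; exact (extChartAt I x₀).map_target hy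

theorem symmL_eq_chartVec {x₀ : M} {y : E} (hy : y ∈ (extChartAt I x₀).target) :
    (trivializationAt E (TangentSpace I) x₀).symmL ℝ ((extChartAt I x₀).symm y) =
      chartVec I x₀ y := by
  have h := TangentBundle.symmL_trivializationAt (I := I) (mem_chart_source_of_mem_target hy)
  rw [(extChartAt I x₀).right_inv hy] at h
  exact h

theorem chartMetric_apply {x₀ : M} {y : E} (hy : y ∈ (extChartAt I x₀).target) (v w : E) :
    g.chartMetric x₀ y v w =
      g.metric ((extChartAt I x₀).symm y) (chartVec I x₀ y v) (chartVec I x₀ y w) := by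
  rw [chartMetric, coordMetric_apply g (mem_chart_source_of_mem_target hy), symmL_eq_chartVec hy]

theorem chartMetric_self (x₀ : M) (v w : E) :
    g.chartMetric x₀ (extChartAt I x₀ x₀) v w =
      g.metric x₀ (v : TangentSpace I x₀) (w : TangentSpace I x₀) := by
  rw [chartMetric, extChartAt_to_inv, coordMetric_self]

theorem chartVec_ne_zero {x₀ : M} {y : E} (hy : y ∈ (extChartAt I x₀).target) {w : E}
    (hw : w ≠ 0) : chartVec I x₀ y w ≠ 0 := by
  intro h
  have h1 := (isInvertible_mfderivWithin_extChartAt_symm (I := I) hy).injective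
  exact hw (h1 (h.trans (map_zero (chartVec I x₀ y)).symm))

theorem contDiffWithinAt_chartMetric (x₀ : M) :
    ContDiffWithinAt ℝ 1 (g.chartMetric x₀) (range I) (extChartAt I x₀ x₀) := by
  have h := (contMDiffAt_hom_bundle _).1 (g.contMDiff_metric x₀)
  have h2 := (contMDiffAt_iff.1 h.2).2
  simp only [mfld_simps] at h2
  exact (h2.of_le (by norm_cast)).congr_of_eventuallyEq (Eventually.of_forall fun y ↦ rfl) rfl

/-- The product of the time direction with the vector field of constant components `v` depends
continuously on the coordinates. -/
theorem continuousWithinAt_metric_timeDir (x₀ : M) (v : E) :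
    ContinuousWithinAt (fun y ↦ g.metric ((extChartAt I x₀).symm y)
      (g.timeDir ((extChartAt I x₀).symm y)) (chartVec I x₀ y v)) (range I)
      (extChartAt I x₀ x₀) := by
  have h1 := ((FiberBundle.continuousAt_totalSpace E
    (fun x ↦ (⟨x, g.timeDir x⟩ : TangentBundle I M))).1
    (g.continuous_timeDir.continuousAt (x := x₀))).2
  have h2 : ContinuousWithinAt (fun y ↦ (trivializationAt E (TangentSpace I) x₀
      ⟨(extChartAt I x₀).symm y, g.timeDir ((extChartAt I x₀).symm y)⟩).2) (range I)
      (extChartAt I x₀ x₀) := by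
    have hc : ContinuousAt (fun x ↦ (trivializationAt E (TangentSpace I) x₀ ⟨x, g.timeDir x⟩).2)
        ((extChartAt I x₀).symm (extChartAt I x₀ x₀)) := by
      rw [extChartAt_to_inv]
      exact h1
    exact hc.comp_continuousWithinAt (continuousAt_extChartAt_symm x₀).continuousWithinAt
  have h3 := (g.contDiffWithinAt_chartMetric x₀).continuousWithinAt
  have h4 := (h3.clm_apply h2).clm_apply (continuousWithinAt_const (b := v))
  have h5 : ∀ y ∈ (extChartAt I x₀).target, g.metric ((extChartAt I x₀).symm y)
      (g.timeDir ((extChartAt I x₀).symm y)) (chartVec I x₀ y v) =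
      g.chartMetric x₀ y (trivializationAt E (TangentSpace I) x₀
      ⟨(extChartAt I x₀).symm y, g.timeDir ((extChartAt I x₀).symm y)⟩).2 v := by
    intro y hy
    have hb : (extChartAt I x₀).symm y ∈ (trivializationAt E (TangentSpace I) x₀).baseSet := by
      simpa using mem_chart_source_of_mem_target hy
    rw [g.chartMetric_apply hy, ← symmL_eq_chartVec hy]
    congr 2
    rw [Bundle.Trivialization.symmL_apply _ hb]
    exact (Bundle.Trivialization.symm_apply_apply_mk _ hb _).symm
  exact h4.congr_of_eventuallyEq
    (Filter.mem_of_superset (extChartAt_target_mem_nhdsWithin x₀) h5)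
    (h5 _ (mem_extChartAt_target x₀))

theorem metric_ne_zero {x : M} {v w : TangentSpace I x} (hv : g.metric x v v < 0) (hw : w ≠ 0)
    (hww : g.metric x w w ≤ 0) : g.metric x v w ≠ 0 := fun h ↦
  absurd (g.pos_of_orthogonal x v w hv h hw) (not_lt.2 hww)

/-- Two timelike vectors in the same time cone agree about which causal vectors are future-directed:
the segment between them consists of timelike vectors, none of which is orthogonal to a causal
vector. -/
theorem metric_neg_iff {x : M} {u v w : TangentSpace I x} (hu : g.metric x u u < 0)
    (hv : g.metric x v v < 0) (huv : g.metric x u v < 0) (hw : w ≠ 0)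
    (hww : g.metric x w w ≤ 0) : g.metric x u w < 0 ↔ g.metric x v w < 0 := by
  -- a zero of `s ↦ metric x ((1 - s) u + s v) w` is excluded
  have key : ∀ a b : ℝ, 0 < a → 0 < b → a * g.metric x u w + b * g.metric x v w ≠ 0 := by
    intro a b ha hb h
    have h1 : g.metric x (a • u + b • v) (a • u + b • v) < 0 := by
      simp only [map_add, map_smul, add_apply, smul_apply,
        smul_eq_mul, g.symm x v u]
      nlinarith [mul_neg_of_pos_of_neg (mul_pos ha ha) hu,
        mul_neg_of_pos_of_neg (mul_pos hb hb) hv, mul_neg_of_pos_of_neg (mul_pos ha hb) huv]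
    apply g.metric_ne_zero h1 hw hww
    simpa only [map_add, map_smul, add_apply, smul_apply,
        smul_eq_mul] using h
  have hu0 := g.metric_ne_zero hu hw hww
  have hv0 := g.metric_ne_zero hv hw hww
  constructor
  · intro h
    by_contra h'
    have h'' : 0 < g.metric x v w := lt_of_le_of_ne (not_lt.1 h') hv0.symm
    exact key _ _ h'' (neg_pos.2 h) (by ring)
  · intro h
    by_contra h'
    have h'' : 0 < g.metric x u w := lt_of_le_of_ne (not_lt.1 h') hu0.symm
    exact key _ _ (neg_pos.2 h) h'' (by ring)

/-! ### Coordinates adapted to the light cones -/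

/-- Through each point passes a future-directed timelike direction `v` such that short translations
by multiples of `v` do not leave the manifold: in the interior every timelike vector will do; on the
boundary a timelike vector tangent to it is taken. -/
theorem exists_timelike_translation [FiniteDimensional ℝ E] {ℓ : E →L[ℝ] ℝ}
    (hI : range I = {y : E | 0 ≤ ℓ y}) (hbdry : g.HasTimelikeBoundary ℓ) (x₀ : M) :
    ∃ v : E, g.metric x₀ (v : TangentSpace I x₀) v < 0 ∧
      g.metric x₀ (g.timeDir x₀) (v : TangentSpace I x₀) < 0 ∧ ∃ ρ > 0,
        ∀ y ∈ Metric.ball (extChartAt I x₀ x₀) ρ ∩ range I, ∀ t : ℝ, |t| < ρ →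
          y + t • v ∈ range I := by
  by_cases hx : x₀ ∈ I.boundary M
  · obtain ⟨v, hv0, hv⟩ := hbdry x₀ hx
    have hv' : (v : TangentSpace I x₀) ≠ 0 := by
      intro h
      have hv1 : g.metric x₀ (0 : TangentSpace I x₀) (0 : TangentSpace I x₀) < 0 := h ▸ hv
      rw [map_zero] at hv1
      exact lt_irrefl _ hv1
    have hrange : ∀ w : E, ℓ w = 0 → ∀ y ∈ range I, ∀ t : ℝ, y + t • w ∈ range I := by
      intro w hw y hy t
      rw [hI] at hy ⊢
      simpa [hw] using hy
    rcases lt_or_gt_of_ne (g.metric_ne_zero (g.metric_timeDir_neg x₀) hv' hv.le) with h | h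
    · exact ⟨v, hv, h, 1, one_pos, fun y hy t _ ↦ hrange v hv0 y hy.2 t⟩
    · refine ⟨-v, ?_, ?_, 1, one_pos, fun y hy t _ ↦ hrange (-v) (by simp [hv0]) y hy.2 t⟩
      · have := (g.metric x₀).map_neg (v : TangentSpace I x₀)
        erw [this, neg_apply, map_neg, neg_neg]
        exact hv
      · erw [map_neg]
        exact neg_neg_of_pos h
  · have hint : I.IsInteriorPoint x₀ := by
      by_contra h
      exact hx ((I.isInteriorPoint_or_isBoundaryPoint x₀).resolve_left h)
    obtain ⟨δ, hδ, hball⟩ := Metric.mem_nhds_iff.1 (mem_interior_iff_mem_nhds.1 hint)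
    let v : E := g.timeDir x₀
    refine ⟨v, g.metric_timeDir_neg x₀, g.metric_timeDir_neg x₀, δ / (1 + ‖v‖), by positivity, ?_⟩
    intro y hy t ht
    apply hball
    have h1 : ‖y - extChartAt I x₀ x₀‖ < δ / (1 + ‖v‖) := by simpa [dist_eq_norm] using hy.1
    rw [Metric.mem_ball, dist_eq_norm]
    calc ‖y + t • v - extChartAt I x₀ x₀‖ = ‖(y - extChartAt I x₀ x₀) + t • v‖ := by
          congr 1; abel
      _ ≤ ‖y - extChartAt I x₀ x₀‖ + ‖t • v‖ := norm_add_le _ _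
      _ = ‖y - extChartAt I x₀ x₀‖ + |t| * ‖v‖ := by rw [norm_smul, Real.norm_eq_abs]
      _ < δ / (1 + ‖v‖) + δ / (1 + ‖v‖) * ‖v‖ :=
          add_lt_add_of_lt_of_le h1 (mul_le_mul_of_nonneg_right ht.le (norm_nonneg v))
      _ = δ := by field_simp

/-- Uniform control of the metric `G y = g.chartMetric x₀ y` for `y` in the ball of radius `r` of
the chart at `x₀`, by means of a future-directed timelike vector `v`: the metric is bounded and
Lipschitz with constant `C`, the product `G y v w` of `v` with a causal vector `w` is at least
`c ‖w‖` in absolute value, and `w` is future-directed if this product is negative. Translations by `t • v` with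
`|t| < r` stay in the half-space. -/
structure IsAdapted (x₀ : M) (v : E) (r c C : ℝ) : Prop where
  r_pos : 0 < r
  c_pos : 0 < c
  C_pos : 0 < C
  subset_target : Metric.ball (extChartAt I x₀ x₀) r ∩ range I ⊆ (extChartAt I x₀).target
  translate : ∀ y ∈ Metric.ball (extChartAt I x₀ x₀) r ∩ range I, ∀ t : ℝ, |t| < r →
    y + t • v ∈ range I
  timelike : ∀ y ∈ Metric.ball (extChartAt I x₀ x₀) r ∩ range I, g.chartMetric x₀ y v v ≤ -c
  causal_bound : ∀ y ∈ Metric.ball (extChartAt I x₀ x₀) r ∩ range I, ∀ w : E,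
    g.chartMetric x₀ y w w ≤ 0 → c * ‖w‖ ≤ |g.chartMetric x₀ y v w|
  lipschitz : ∀ y ∈ Metric.ball (extChartAt I x₀ x₀) r ∩ range I,
    ∀ y' ∈ Metric.ball (extChartAt I x₀ x₀) r ∩ range I,
    ‖g.chartMetric x₀ y - g.chartMetric x₀ y'‖ ≤ C * ‖y - y'‖
  bounded : ∀ y ∈ Metric.ball (extChartAt I x₀ x₀) r ∩ range I, ‖g.chartMetric x₀ y‖ ≤ C
  future_iff : ∀ y ∈ Metric.ball (extChartAt I x₀ x₀) r ∩ range I, ∀ w : E,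
    g.IsFutureCausal ((extChartAt I x₀).symm y) (chartVec I x₀ y w) ↔
      w ≠ 0 ∧ g.chartMetric x₀ y w w ≤ 0 ∧ g.chartMetric x₀ y v w < 0

/-- Near a bilinear form all of whose nonzero null or timelike vectors have nonzero product with
`v`, this product is bounded below uniformly. -/
theorem exists_causal_bound [FiniteDimensional ℝ E] (B : E →L[ℝ] E →L[ℝ] ℝ) (v : E)
    (hB : ∀ w : E, w ≠ 0 → B w w ≤ 0 → B v w ≠ 0) :
    ∃ c > 0, ∃ δ > 0, ∀ B' : E →L[ℝ] E →L[ℝ] ℝ, ‖B' - B‖ ≤ δ → ∀ w : E, B' w w ≤ 0 →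
      c * ‖w‖ ≤ |B' v w| := by
  obtain ⟨m, hm, hmin⟩ := (isCompact_sphere (0 : E) 1).exists_forall_le'
    (f := fun w ↦ max (B w w) |B v w|) (a := 0) (by fun_prop) (by
      intro w hw
      have hw0 : w ≠ 0 := by
        rintro rfl
        simp at hw
      rcases lt_or_ge 0 (B w w) with h | h
      · exact lt_max_of_lt_left h
      · exact lt_max_of_lt_right (abs_pos.2 (hB w hw0 h)))
  refine ⟨m / 2, by positivity, m / (4 * (1 + ‖v‖)), by positivity, fun B' hB' ↦ ?_⟩
  have hsphere : ∀ w ∈ Metric.sphere (0 : E) 1, B' w w ≤ 0 → m / 2 ≤ |B' v w| := by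
    intro w hw hww
    have hw1 : ‖w‖ = 1 := by simpa using hw
    have hδ : ∀ u : E, |B' u w - B u w| ≤ m / (4 * (1 + ‖v‖)) * ‖u‖ := by
      intro u
      have := (B' - B).le_opNorm₂ u w
      rw [hw1, mul_one, Real.norm_eq_abs] at this
      exact this.trans (mul_le_mul_of_nonneg_right hB' (norm_nonneg u))
    have h1 := hδ w
    have h2 := hδ v
    have h3 : m / (4 * (1 + ‖v‖)) * ‖v‖ ≤ m / 4 := by
      rw [div_mul_eq_mul_div, div_le_div_iff₀ (by positivity) (by positivity)]
      nlinarith [norm_nonneg v]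
    have h4 : m / (4 * (1 + ‖v‖)) ≤ m / 4 :=
      div_le_div_of_nonneg_left hm.le (by positivity) (by linarith [norm_nonneg v])
    rw [hw1, mul_one] at h1
    rcases le_max_iff.1 (hmin w hw) with h | h
    · linarith [(abs_le.1 h1).1]
    · have := abs_sub_abs_le_abs_sub (B v w) (B' v w)
      rw [abs_sub_comm] at this
      linarith
  intro w hw
  rcases eq_or_ne w 0 with rfl | hw0
  · simp
  have hn : 0 < ‖w‖ := norm_pos_iff.2 hw0
  have h := hsphere (‖w‖⁻¹ • w) (by simp [norm_smul, hn.ne']) (by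
    simp only [map_smul, smul_apply, smul_eq_mul]
    exact mul_nonpos_of_nonneg_of_nonpos (by positivity)
      (mul_nonpos_of_nonneg_of_nonpos (by positivity) hw))
  rw [map_smul, smul_eq_mul, abs_mul, abs_of_pos (inv_pos.2 hn)] at h
  calc m / 2 * ‖w‖ ≤ ‖w‖⁻¹ * |B' v w| * ‖w‖ := mul_le_mul_of_nonneg_right h hn.le
    _ = |B' v w| := by field_simp

/-- Every point has an adapted vector `v`, by continuity of the metric and of the time
orientation. -/
theorem exists_isAdapted [FiniteDimensional ℝ E] {ℓ : E →L[ℝ] ℝ}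
    (hI : range I = {y : E | 0 ≤ ℓ y}) (hbdry : g.HasTimelikeBoundary ℓ) (x₀ : M) :
    ∃ (v : E) (r c C : ℝ), g.IsAdapted x₀ v r c C := by
  obtain ⟨v, hvv, htv, ρ, hρ, htrans⟩ := g.exists_timelike_translation hI hbdry x₀
  set y₀ := extChartAt I x₀ x₀ with hy₀
  have hconv : Convex ℝ (range I) := by
    rw [hI]
    exact convex_halfSpace_ge ℓ.isLinear 0
  obtain ⟨c₁, hc₁, δ, hδ, hbound⟩ := exists_causal_bound (g.chartMetric x₀ y₀) v (by
    intro w hw hww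
    rw [hy₀, chartMetric_self] at hww ⊢
    exact g.metric_ne_zero hvv hw hww)
  have hcd := g.contDiffWithinAt_chartMetric x₀
  obtain ⟨K, s, hs, hK⟩ := hcd.exists_lipschitzOnWith hconv
  have hcont := hcd.continuousWithinAt
  have e1 : ∀ᶠ y in 𝓝[range I] y₀, ‖g.chartMetric x₀ y - g.chartMetric x₀ y₀‖ < δ := by
    have := hcont (Metric.ball_mem_nhds _ hδ)
    filter_upwards [this] with y hy
    exact mem_ball_iff_norm.1 hy
  have e2 : ∀ᶠ y in 𝓝[range I] y₀, g.chartMetric x₀ y v v < g.chartMetric x₀ y₀ v v / 2 := by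
    have h : ContinuousWithinAt (fun y ↦ g.chartMetric x₀ y v v) (range I) y₀ :=
      (hcont.clm_apply continuousWithinAt_const).clm_apply continuousWithinAt_const
    have h0 : g.chartMetric x₀ y₀ v v < 0 := by rwa [hy₀, chartMetric_self]
    exact h.eventually_lt_const (by linarith)
  have e3 : ∀ᶠ y in 𝓝[range I] y₀, g.metric ((extChartAt I x₀).symm y)
      (g.timeDir ((extChartAt I x₀).symm y)) (chartVec I x₀ y v) < 0 := by
    refine (g.continuousWithinAt_metric_timeDir x₀ v).eventually_lt_const ?_
    have h : ∀ x, x = x₀ → g.metric x (g.timeDir x)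
        ((trivializationAt E (TangentSpace I) x₀).symmL ℝ x v) < 0 := by
      rintro x rfl
      rw [symmL_self]
      exact htv
    beta_reduce
    rw [← symmL_eq_chartVec (mem_extChartAt_target x₀)]
    exact h _ (extChartAt_to_inv x₀)
  have e4 := extChartAt_target_mem_nhdsWithin (I := I) x₀
  have e5 : Metric.ball y₀ ρ ∈ 𝓝[range I] y₀ :=
    mem_nhdsWithin_of_mem_nhds (Metric.ball_mem_nhds _ hρ)
  obtain ⟨r, hr, hball⟩ := Metric.mem_nhdsWithin_iff.1
    (inter_mem hs (inter_mem e1 (inter_mem e2 (inter_mem e3 (inter_mem e4 e5)))))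
  have h0 : g.chartMetric x₀ y₀ v v < 0 := by rwa [hy₀, chartMetric_self]
  refine ⟨v, min r ρ, min c₁ (-(g.chartMetric x₀ y₀ v v / 2)),
    max (K + 1) (‖g.chartMetric x₀ y₀‖ + δ), ?_⟩
  replace hball : Metric.ball y₀ (min r ρ) ∩ range I ⊆ _ :=
    (inter_subset_inter_left _ (Metric.ball_subset_ball (min_le_left _ _))).trans hball
  have htl : ∀ y ∈ Metric.ball y₀ (min r ρ) ∩ range I,
      g.chartMetric x₀ y v v ≤ -(min c₁ (-(g.chartMetric x₀ y₀ v v / 2))) := by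
    intro y hy
    have h1 : g.chartMetric x₀ y v v < _ := (hball hy).2.2.1
    linarith [min_le_right c₁ (-(g.chartMetric x₀ y₀ v v / 2))]
  refine ⟨lt_min hr hρ, lt_min hc₁ (by linarith), lt_max_of_lt_left (by positivity),
    fun y hy ↦ (hball hy).2.2.2.2.1, ?_, htl, ?_, ?_, ?_, ?_⟩
  · intro y hy t ht
    exact htrans y ⟨(hball hy).2.2.2.2.2, hy.2⟩ t (ht.trans_le (min_le_right _ _))
  · intro y hy w hw
    have h1 : ‖g.chartMetric x₀ y - _‖ < δ := (hball hy).2.1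
    exact (mul_le_mul_of_nonneg_right (min_le_left _ _) (norm_nonneg w)).trans
      (hbound _ h1.le w hw)
  · intro y hy y' hy'
    refine (hK.norm_sub_le (hball hy).1 (hball hy').1).trans
      (mul_le_mul_of_nonneg_right ?_ (norm_nonneg _))
    exact (by linarith : (K : ℝ) ≤ K + 1).trans (le_max_left _ _)
  · intro y hy
    have h1 : ‖g.chartMetric x₀ y - _‖ < δ := (hball hy).2.1
    refine le_trans ?_ (le_max_right _ _)
    linarith [norm_le_norm_add_norm_sub' (g.chartMetric x₀ y) (g.chartMetric x₀ y₀)]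
  · intro y hy w
    have ht : y ∈ (extChartAt I x₀).target := (hball hy).2.2.2.2.1
    have h3 : g.metric ((extChartAt I x₀).symm y)
      (g.timeDir ((extChartAt I x₀).symm y)) (chartVec I x₀ y v) < 0 := (hball hy).2.2.2.1
    have h2 : g.chartMetric x₀ y v v < _ := (hball hy).2.2.1
    have hvv' : g.metric _ (chartVec I x₀ y v) (chartVec I x₀ y v) < 0 := by
      rw [← g.chartMetric_apply ht]; linarith
    rw [g.chartMetric_apply ht, g.chartMetric_apply ht, IsFutureCausal]
    constructor
    · rintro ⟨hw0, hww, hw⟩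
      refine ⟨?_, hww, (g.metric_neg_iff (g.metric_timeDir_neg _) hvv' h3 hw0 hww).1 hw⟩
      rintro rfl
      exact hw0 (map_zero _)
    · rintro ⟨hw0, hww, hw⟩
      have hw0' := chartVec_ne_zero ht hw0
      exact ⟨hw0', hww, (g.metric_neg_iff (g.metric_timeDir_neg _) hvv' h3 hw0' hww).2 hw⟩

/-! ### Deforming causal arcs in a chart -/

theorem mfderivWithin_extChartAt_symm_comp {x₀ : M} {c : ℝ → E} {s : Set ℝ} {u : ℝ}
    (hs : UniqueDiffWithinAt ℝ s u)
    (hc : DifferentiableWithinAt ℝ c s u) (hmem : MapsTo c s (extChartAt I x₀).target)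
    (hu : u ∈ s) :
    mfderivWithin 𝓘(ℝ) I ((extChartAt I x₀).symm ∘ c) s u (1 : ℝ) =
      chartVec I x₀ (c u) (derivWithin c s u) := by
  have h1 : MDifferentiableWithinAt 𝓘(ℝ, E) I (extChartAt I x₀).symm (range I) (c u) :=
    mdifferentiableWithinAt_extChartAt_symm (hmem hu)
  rw [mfderivWithin_comp u h1 hc.mdifferentiableWithinAt
    (fun a ha ↦ extChartAt_target_subset_range x₀ (hmem ha)) hs.uniqueMDiffWithinAt,
    mfderivWithin_eq_fderivWithin]
  rfl

/-- A curve in a chart whose coordinate velocity is causal is a causal arc. -/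
theorem isCausalArc_of_chart {x₀ : M} {c : ℝ → E} {s t : ℝ} (hst : s < t)
    (hc : ContDiffOn ℝ 1 c (Icc s t)) (hmem : MapsTo c (Icc s t) (extChartAt I x₀).target)
    (hv : ∀ u ∈ Icc s t, g.IsFutureCausal ((extChartAt I x₀).symm (c u))
      (chartVec I x₀ (c u) (derivWithin c (Icc s t) u))) :
    g.IsCausalArc ((extChartAt I x₀).symm ∘ c) s t := by
  refine ⟨?_, fun u hu ↦ ?_⟩
  · have h1 : ContMDiffOn 𝓘(ℝ, E) I 1 (extChartAt I x₀).symm (extChartAt I x₀).target :=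
      contMDiffOn_extChartAt_symm x₀
    exact h1.comp hc.contMDiffOn hmem
  · have := mfderivWithin_extChartAt_symm_comp (I := I) (uniqueDiffOn_Icc hst u hu)
      (hc.differentiableOn one_ne_zero u hu) hmem hu
    rw [this]
    exact hv u hu

/-- In a chart, the coordinate velocity of a causal arc is causal. -/
theorem IsCausalArc.chart {x₀ : M} {γ : ℝ → M} {s t : ℝ} (hst : s < t) (h : g.IsCausalArc γ s t)
    (hmem : MapsTo γ (Icc s t) (extChartAt I x₀).source) :
    ContDiffOn ℝ 1 (extChartAt I x₀ ∘ γ) (Icc s t) ∧ ∀ u ∈ Icc s t,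
      g.IsFutureCausal ((extChartAt I x₀).symm ((extChartAt I x₀ ∘ γ) u))
        (chartVec I x₀ ((extChartAt I x₀ ∘ γ) u)
          (derivWithin (extChartAt I x₀ ∘ γ) (Icc s t) u)) := by
  have h1 : ContMDiffOn I 𝓘(ℝ, E) 1 (extChartAt I x₀) (extChartAt I x₀).source := by
    rw [extChartAt_source]
    exact contMDiffOn_extChartAt
  have hc : ContDiffOn ℝ 1 (extChartAt I x₀ ∘ γ) (Icc s t) :=
    (h1.comp h.1 hmem).contDiffOn
  have hmem' : MapsTo (extChartAt I x₀ ∘ γ) (Icc s t) (extChartAt I x₀).target :=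
    fun u hu ↦ (extChartAt I x₀).map_source (hmem hu)
  refine ⟨hc, fun u hu ↦ ?_⟩
  have h2 := mfderivWithin_extChartAt_symm_comp (I := I) (uniqueDiffOn_Icc hst u hu)
      (hc.differentiableOn one_ne_zero u hu) hmem' hu
  rw [← h2]
  have h3 : EqOn ((extChartAt I x₀).symm ∘ (extChartAt I x₀ ∘ γ)) γ (Icc s t) :=
    fun a ha ↦ (extChartAt I x₀).left_inv (hmem ha)
  have h4 := mfderivWithin_congr (I := 𝓘(ℝ)) (I' := I) h3 (h3 hu)
  -- the velocities at `x = γ u` are compared as elements of `E`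
  have h5 : ∀ x, x = γ u → g.IsFutureCausal x (mfderivWithin 𝓘(ℝ) I γ (Icc s t) u (1 : ℝ) : E) := by
    rintro x rfl
    exact h.2 u hu
  rw [h4]
  exact h5 _ (h3 hu)

theorem IsCausalArc.mono {γ : ℝ → M} {s t s' t' : ℝ} (h : g.IsCausalArc γ s t) (hs : s ≤ s')
    (hst : s' < t') (ht : t' ≤ t) : g.IsCausalArc γ s' t' := by
  have hsub : Icc s' t' ⊆ Icc s t := Icc_subset_Icc hs ht
  refine ⟨h.1.mono hsub, fun u hu ↦ ?_⟩
  rw [mfderivWithin_subset hsub (uniqueDiffOn_Icc hst u hu).uniqueMDiffWithinAt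
    ((h.1 u (hsub hu)).mdifferentiableWithinAt one_ne_zero)]
  exact h.2 u (hsub hu)

theorem IsCausalArc.isCausalCurve {γ : ℝ → M} {s t : ℝ} (h : g.IsCausalArc γ s t) :
    g.IsCausalCurve γ (Icc s t) :=
  ⟨ordConnected_Icc, fun _ ha _ hb ↦ ⟨∅, finite_empty, fun _ _ h1 h2 h3 _ ↦
    h.mono g (ha.1.trans h1) h2 (h3.trans hb.2)⟩⟩

theorem IsCausalArc.mem_causalFuture {γ : ℝ → M} {s t : ℝ} (hst : s < t)
    (h : g.IsCausalArc γ s t) : γ t ∈ g.causalFuture (γ s) :=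
  Or.inr ⟨γ, s, t, hst, h.isCausalCurve, rfl, rfl⟩

theorem chartMetric_symm {x₀ : M} {y : E} (hy : y ∈ (extChartAt I x₀).target) (v w : E) :
    g.chartMetric x₀ y v w = g.chartMetric x₀ y w v := by
  rw [g.chartMetric_apply hy, g.chartMetric_apply hy, g.symm]

namespace IsAdapted

variable {g} {x₀ : M} {v : E} {r c C : ℝ} (h : g.IsAdapted x₀ v r c C)
include h

/-- Moving a causal vector `w` from `y` to the nearby point `y - θ v` makes it fail to be causal by
`O(θ ‖w‖²)` only, which the addition of a multiple of `v` of the order of `θ ‖w‖` outweighs. -/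
theorem isFutureCausal_translate {y : E} {θ D : ℝ}
    (hy : y ∈ Metric.ball (extChartAt I x₀ x₀) r ∩ range I)
    (hy' : y - θ • v ∈ Metric.ball (extChartAt I x₀ x₀) r ∩ range I) (hθ : 0 < θ) (hD : 0 < D)
    {w : E} (hw : g.IsFutureCausal ((extChartAt I x₀).symm y) (chartVec I x₀ y w))
    (hθ' : θ * C * ‖v‖ ^ 2 ≤ c / 2) (hD' : C * ‖v‖ * ‖w‖ ≤ c * D) :
    g.IsFutureCausal ((extChartAt I x₀).symm (y - θ • v))
      (chartVec I x₀ (y - θ • v) (w + (D * θ) • v)) := by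
  rw [h.future_iff y hy] at hw
  obtain ⟨hw0, hww, hvw⟩ := hw
  have hw1 : 0 < ‖w‖ := norm_pos_iff.2 hw0
  have hc := h.c_pos
  have hC := h.C_pos
  set B := g.chartMetric x₀ y
  set B' := g.chartMetric x₀ (y - θ • v) with hB'
  have hdiff : ∀ a : E, |B' a w - B a w| ≤ C * θ * ‖v‖ * ‖a‖ * ‖w‖ := by
    intro a
    have h1 := (B' - B).le_opNorm₂ a w
    have h2 := h.lipschitz _ hy' _ hy
    have h3 : ‖y - θ • v - y‖ = θ * ‖v‖ := by
      rw [sub_sub_cancel_left, norm_neg, norm_smul, Real.norm_eq_abs, abs_of_pos hθ]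
    rw [h3] at h2
    rw [Real.norm_eq_abs] at h1
    calc |B' a w - B a w| ≤ ‖B' - B‖ * ‖a‖ * ‖w‖ := h1
      _ ≤ (C * (θ * ‖v‖)) * ‖a‖ * ‖w‖ := by gcongr
      _ = _ := by ring
  have hvv := h.timelike _ hy'
  have hb := h.causal_bound y hy w hww
  rw [abs_of_neg hvw] at hb
  have h1 := (abs_le.1 (hdiff w)).2
  have h2 := (abs_le.1 (hdiff v)).2
  -- the product of `w` with `v` stays negative
  have h3 : B' v w ≤ -(c / 2) * ‖w‖ := by
    have : C * θ * ‖v‖ * ‖v‖ * ‖w‖ ≤ c / 2 * ‖w‖ := by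
      calc C * θ * ‖v‖ * ‖v‖ * ‖w‖ = (θ * C * ‖v‖ ^ 2) * ‖w‖ := by ring
        _ ≤ _ := by gcongr
    linarith
  have hsymm : B' w v = B' v w := g.chartMetric_symm (h.subset_target hy') _ _
  have hDθ : 0 < D * θ := mul_pos hD hθ
  have hneg : B' v (w + (D * θ) • v) < 0 := by
    rw [map_add, map_smul, smul_eq_mul]
    have : -(c / 2) * ‖w‖ < 0 := by nlinarith
    nlinarith
  rw [h.future_iff _ hy']
  refine ⟨?_, ?_, hneg⟩
  · intro h0
    rw [h0, map_zero] at hneg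
    exact lt_irrefl _ hneg
  · have hexp : B' (w + (D * θ) • v) (w + (D * θ) • v) =
        B' w w + 2 * (D * θ) * B' v w + (D * θ) ^ 2 * B' v v := by
      simp only [map_add, map_smul, add_apply, smul_apply, smul_eq_mul, hsymm]
      ring
    rw [← hB', hexp]
    have h4 : C * θ * ‖v‖ * ‖w‖ * ‖w‖ ≤ D * θ * c * ‖w‖ := by
      calc C * θ * ‖v‖ * ‖w‖ * ‖w‖ = (C * ‖v‖ * ‖w‖) * (θ * ‖w‖) := by ring
        _ ≤ (c * D) * (θ * ‖w‖) := by gcongr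
        _ = _ := by ring
    have h5 : 2 * (D * θ) * B' v w ≤ 2 * (D * θ) * (-(c / 2) * ‖w‖) := by gcongr
    have h6 : (D * θ) ^ 2 * B' v v ≤ 0 :=
      mul_nonpos_of_nonneg_of_nonpos (by positivity) (by linarith)
    linarith

theorem sub_smul_mem {y : E} {θ : ℝ}
    (hy : y ∈ Metric.ball (extChartAt I x₀ x₀) (r / 2) ∩ range I) (hθ : |θ| < r)
    (hθ' : |θ| * ‖v‖ < r / 2) :
    y - θ • v ∈ Metric.ball (extChartAt I x₀ x₀) r ∩ range I := by
  have hr := h.r_pos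
  constructor
  · have h1 := mem_ball_iff_norm.1 hy.1
    rw [mem_ball_iff_norm]
    calc ‖y - θ • v - extChartAt I x₀ x₀‖ = ‖(y - extChartAt I x₀ x₀) - θ • v‖ := by
          congr 1; abel
      _ ≤ ‖y - extChartAt I x₀ x₀‖ + ‖θ • v‖ := norm_sub_le _ _
      _ < r / 2 + r / 2 := by
          rw [norm_smul, Real.norm_eq_abs]
          exact add_lt_add h1 hθ'
      _ = r := by ring
  · have := h.translate y ⟨Metric.ball_subset_ball (by linarith) hy.1, hy.2⟩ (-θ) (by rwa [abs_neg])
    rwa [neg_smul, ← sub_eq_add_neg] at this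

/-- A causal arc `γ` in the chart can be deformed into the arc `γ - θ v`, where `θ` decreases
exponentially, fast enough for the deformed arc to be causal. -/
theorem exists_pushed_arc {γ : ℝ → E} {s t : ℝ} (hst : s < t) (hγ : ContDiffOn ℝ 1 γ (Icc s t))
    (hmem : MapsTo γ (Icc s t) (Metric.ball (extChartAt I x₀ x₀) (r / 2) ∩ range I))
    (hv : ∀ u ∈ Icc s t, g.IsFutureCausal ((extChartAt I x₀).symm (γ u))
      (chartVec I x₀ (γ u) (derivWithin γ (Icc s t) u))) {ε : ℝ} (hε : 0 < ε) :
    ∃ κ ∈ Ioo 0 ε, ∃ κ' ∈ Ioo 0 ε,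
      (extChartAt I x₀).symm (γ t - κ • v) ∈
        g.causalFuture ((extChartAt I x₀).symm (γ s - κ' • v)) := by
  have hr := h.r_pos
  have hc := h.c_pos
  have hC := h.C_pos
  obtain ⟨W, hW⟩ := isCompact_Icc.exists_bound_of_continuousOn
    (hγ.continuousOn_derivWithin (uniqueDiffOn_Icc hst) le_rfl)
  have hW0 : 0 ≤ W := (norm_nonneg _).trans (hW s ⟨le_rfl, hst.le⟩)
  set D := (C * ‖v‖ * W + 1) / c with hDdef
  have hD : 0 < D := by positivity
  have hDW : ∀ u ∈ Icc s t, C * ‖v‖ * ‖derivWithin γ (Icc s t) u‖ ≤ c * D := by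
    intro u hu
    have h1 : c * D = C * ‖v‖ * W + 1 := by rw [hDdef]; field_simp
    rw [h1]
    have := mul_le_mul_of_nonneg_left (hW u hu) (show 0 ≤ C * ‖v‖ by positivity)
    linarith
  -- an upper bound for the displacement
  obtain ⟨Θ, hΘ, hΘε, hΘr, hΘv, hΘC⟩ : ∃ Θ > 0, Θ < ε ∧ Θ < r ∧ Θ * ‖v‖ < r / 2 ∧
      Θ * C * ‖v‖ ^ 2 ≤ c / 2 := by
    have l1 : Tendsto (fun Θ : ℝ ↦ Θ) (𝓝[>] 0) (𝓝 0) := nhdsWithin_le_nhds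
    have l2 : Tendsto (fun Θ : ℝ ↦ Θ * ‖v‖) (𝓝[>] 0) (𝓝 0) := by
      simpa using l1.mul_const ‖v‖
    have l3 : Tendsto (fun Θ : ℝ ↦ Θ * C * ‖v‖ ^ 2) (𝓝[>] 0) (𝓝 0) := by
      simpa using (l1.mul_const C).mul_const (‖v‖ ^ 2)
    obtain ⟨Θ, h0, h1, h2, h3, h4⟩ := ((eventually_mem_nhdsWithin (a := (0 : ℝ)) (s := Ioi 0)).and
      ((l1.eventually_lt_const hε).and ((l1.eventually_lt_const hr).and
      ((l2.eventually_lt_const (half_pos hr)).and (l3.eventually_lt_const (half_pos hc)))))).exists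
    exact ⟨Θ, h0, h1, h2, h3, h4.le⟩
  set θ : ℝ → ℝ := fun u ↦ Θ * Real.exp (D * (s - u)) with hθdef
  have hθpos : ∀ u, 0 < θ u := fun u ↦ by positivity
  have hθle : ∀ u ∈ Icc s t, θ u ≤ Θ := by
    intro u hu
    refine mul_le_of_le_one_right hΘ.le (Real.exp_le_one_iff.2 ?_)
    exact mul_nonpos_of_nonneg_of_nonpos hD.le (by linarith [hu.1])
  have hθderiv : ∀ u, HasDerivAt θ (-(D * θ u)) u := by
    intro u
    have h1 : HasDerivAt (fun u ↦ D * (s - u)) (D * (-1)) u :=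
      ((hasDerivAt_id u).const_sub s).const_mul D
    convert! (h1.exp).const_mul Θ using 1
    simp only [hθdef]
    ring
  have hθsmooth : ContDiff ℝ 1 θ := by
    simp only [hθdef]
    fun_prop
  have hmem' : ∀ u ∈ Icc s t, γ u - θ u • v ∈ Metric.ball (extChartAt I x₀ x₀) r ∩ range I := by
    intro u hu
    refine h.sub_smul_mem (hmem hu) ?_ ?_
    · rw [abs_of_pos (hθpos u)]
      exact (hθle u hu).trans_lt hΘr
    · rw [abs_of_pos (hθpos u)]
      exact (mul_le_mul_of_nonneg_right (hθle u hu) (norm_nonneg v)).trans_lt hΘv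
  have harc : g.IsCausalArc ((extChartAt I x₀).symm ∘ fun u ↦ γ u - θ u • v) s t := by
    refine g.isCausalArc_of_chart hst (hγ.sub (hθsmooth.contDiffOn.smul contDiffOn_const))
      (fun u hu ↦ h.subset_target (hmem' u hu)) fun u hu ↦ ?_
    have hd : derivWithin (fun u ↦ γ u - θ u • v) (Icc s t) u =
        derivWithin γ (Icc s t) u + (D * θ u) • v := by
      have h1 := (hγ.differentiableOn one_ne_zero u hu).hasDerivWithinAt
      have h2 := (hθderiv u).hasDerivWithinAt (s := Icc s t)
      refine ((h1.sub (h2.smul_const v)).derivWithin (uniqueDiffOn_Icc hst u hu)).trans ?_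
      rw [neg_smul, sub_neg_eq_add]
    rw [hd]
    refine h.isFutureCausal_translate ?_ (hmem' u hu) (hθpos u) hD (hv u hu) ?_ (hDW u hu)
    · exact ⟨Metric.ball_subset_ball (by linarith) (hmem hu).1, (hmem hu).2⟩
    · refine le_trans ?_ hΘC
      gcongr
      exact hθle u hu
  refine ⟨θ t, ⟨hθpos t, (hθle t ⟨hst.le, le_rfl⟩).trans_lt hΘε⟩, θ s,
    ⟨hθpos s, (hθle s ⟨le_rfl, hst.le⟩).trans_lt hΘε⟩, harc.mem_causalFuture g hst⟩

/-- All points close to `y` are reached from `y - κ v` along straight lines. -/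
theorem exists_causalFuture_mem_nhdsWithin (hconv : Convex ℝ (range I)) {y : E}
    (hy : y ∈ Metric.ball (extChartAt I x₀ x₀) (r / 2) ∩ range I) :
    ∃ ε > (0 : ℝ), ∀ κ ∈ Ioo 0 ε, ∀ᶠ z in 𝓝[range I] y, (extChartAt I x₀).symm z ∈
      g.causalFuture ((extChartAt I x₀).symm (y - κ • v)) := by
  have hr := h.r_pos
  have hc := h.c_pos
  have hC := h.C_pos
  refine ⟨min r (r / (2 * (‖v‖ + 1))), lt_min hr (by positivity), fun κ hκ ↦ ?_⟩
  have hκ0 : 0 < κ := hκ.1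
  have hyκ : y - κ • v ∈ Metric.ball (extChartAt I x₀ x₀) r ∩ range I := by
    refine h.sub_smul_mem hy ?_ ?_
    · rw [abs_of_pos hκ0]
      exact hκ.2.trans_le (min_le_left _ _)
    · rw [abs_of_pos hκ0]
      have h1 := hκ.2.trans_le (min_le_right _ _)
      rw [lt_div_iff₀ (by positivity)] at h1
      linarith
  have hconv' : Convex ℝ (Metric.ball (extChartAt I x₀ x₀) r ∩ range I) :=
    (convex_ball _ _).inter hconv
  have hd : Tendsto (fun z ↦ ‖z - y‖) (𝓝[range I] y) (𝓝 0) :=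
    (tendsto_norm_sub_self y).mono_left nhdsWithin_le_nhds
  have e1 : ∀ᶠ z in 𝓝[range I] y, z ∈ Metric.ball (extChartAt I x₀ x₀) r :=
    mem_nhdsWithin_of_mem_nhds (Metric.isOpen_ball.mem_nhds
      (Metric.ball_subset_ball (by linarith) hy.1))
  have e2 : ∀ᶠ z in 𝓝[range I] y,
      C * ‖z - y‖ * ‖z - y‖ + 2 * κ * (C * ‖v‖ * ‖z - y‖) < κ ^ 2 * c := by
    have : Tendsto (fun z ↦ C * ‖z - y‖ * ‖z - y‖ + 2 * κ * (C * ‖v‖ * ‖z - y‖)) (𝓝[range I] y)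
        (𝓝 0) := by
      simpa using ((hd.const_mul C).mul hd).add ((hd.const_mul (C * ‖v‖)).const_mul (2 * κ))
    exact this.eventually_lt_const (by positivity)
  have e3 : ∀ᶠ z in 𝓝[range I] y, C * ‖v‖ * ‖z - y‖ < κ * c := by
    have : Tendsto (fun z ↦ C * ‖v‖ * ‖z - y‖) (𝓝[range I] y) (𝓝 0) := by
      simpa using hd.const_mul (C * ‖v‖)
    exact this.eventually_lt_const (by positivity)
  filter_upwards [e1, e2, e3, self_mem_nhdsWithin] with z hz1 hz2 hz3 hz4
  set w := z - y + κ • v with hw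
  have hmem : ∀ u ∈ Icc (0 : ℝ) 1, y - κ • v + u • w ∈
      Metric.ball (extChartAt I x₀ x₀) r ∩ range I := by
    intro u hu
    have := hconv'.add_smul_sub_mem hyκ ⟨hz1, hz4⟩ hu
    convert this using 3
    rw [hw]
    abel
  have harc : g.IsCausalArc ((extChartAt I x₀).symm ∘ fun u : ℝ ↦ y - κ • v + u • w) 0 1 := by
    refine g.isCausalArc_of_chart zero_lt_one (by fun_prop)
      (fun u hu ↦ h.subset_target (hmem u hu)) fun u hu ↦ ?_
    have hdw : derivWithin (fun u : ℝ ↦ y - κ • v + u • w) (Icc 0 1) u = w := by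
      have h1 : HasDerivAt (fun u : ℝ ↦ y - κ • v + u • w) ((1 : ℝ) • w) u :=
        ((hasDerivAt_id u).smul_const w).const_add _
      rw [h1.hasDerivWithinAt.derivWithin (uniqueDiffOn_Icc zero_lt_one u hu), one_smul]
    rw [hdw]
    have hu' := hmem u hu
    set p := y - κ • v + u • w
    set B := g.chartMetric x₀ p with hB
    have hbd : ∀ a b : E, |B a b| ≤ C * ‖a‖ * ‖b‖ := by
      intro a b
      calc |B a b| ≤ ‖B‖ * ‖a‖ * ‖b‖ := B.le_opNorm₂ a b
        _ ≤ C * ‖a‖ * ‖b‖ := by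
          gcongr
          exact h.bounded p hu'
    have hvv := h.timelike p hu'
    have hsymm : B (z - y) v = B v (z - y) := g.chartMetric_symm (h.subset_target hu') _ _
    have h1 := (abs_le.1 (hbd (z - y) (z - y))).2
    have h2 := (abs_le.1 (hbd v (z - y))).2
    have hneg : B v w < 0 := by
      rw [hw, map_add, map_smul, smul_eq_mul]
      nlinarith
    rw [h.future_iff p hu']
    refine ⟨?_, ?_, hneg⟩
    · intro h0
      rw [h0, map_zero] at hneg
      exact lt_irrefl _ hneg
    · have hexp : B w w = B (z - y) (z - y) + 2 * κ * B v (z - y) + κ ^ 2 * B v v := by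
        simp only [hw, map_add, map_smul, add_apply, smul_apply, smul_eq_mul, hsymm]
        ring
      rw [← hB, hexp]
      have h3 : 2 * κ * B v (z - y) ≤ 2 * κ * (C * ‖v‖ * ‖z - y‖) := by gcongr
      have h4 : κ ^ 2 * B v v ≤ κ ^ 2 * (-c) := by gcongr
      linarith
  have hfin := harc.mem_causalFuture g zero_lt_one
  have hz : y - κ • v + w = z := by rw [hw]; abel
  simpa [hz] using hfin

end IsAdapted

/-! ### Concatenation and continuity of causal curves -/

theorem IsCausalArc.congr {γ γ' : ℝ → M} {s t : ℝ} (h : g.IsCausalArc γ s t)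
    (he : EqOn γ' γ (Icc s t)) : g.IsCausalArc γ' s t := by
  refine ⟨h.1.congr he, fun u hu ↦ ?_⟩
  have h4 := mfderivWithin_congr (I := 𝓘(ℝ)) (I' := I) he (he hu)
  -- the velocities at `x = γ u` are compared as elements of `E`
  have h5 : ∀ x, x = γ u → g.IsFutureCausal x (mfderivWithin 𝓘(ℝ) I γ (Icc s t) u (1 : ℝ) : E) := by
    rintro x rfl
    exact h.2 u hu
  rw [h4]
  exact h5 _ (he hu)

omit [IsManifold I ∞ M] in
/-- The velocity of an affinely reparametrized curve. -/
theorem mfderivWithin_comp_affine {γ : ℝ → M} {s t s' t' σ k : ℝ} (hst : s < t)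
    (h : ContMDiffOn 𝓘(ℝ) I 1 γ (Icc s' t'))
    (hmap : MapsTo (fun u ↦ σ * u + k) (Icc s t) (Icc s' t')) {u : ℝ} (hu : u ∈ Icc s t) :
    mfderivWithin 𝓘(ℝ) I (γ ∘ fun u ↦ σ * u + k) (Icc s t) u (1 : ℝ) =
      σ • mfderivWithin 𝓘(ℝ) I γ (Icc s' t') (σ * u + k) (1 : ℝ) := by
  have hd : HasDerivAt (fun u ↦ σ * u + k) σ u := by
    simpa using ((hasDerivAt_id u).const_mul σ).add_const k
  have hu' := uniqueDiffOn_Icc hst u hu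
  rw [mfderivWithin_comp u ((h _ (hmap hu)).mdifferentiableWithinAt one_ne_zero)
    hd.differentiableAt.differentiableWithinAt.mdifferentiableWithinAt hmap hu'.uniqueMDiffWithinAt,
    mfderivWithin_eq_fderivWithin]
  have h1 : fderivWithin ℝ (fun u ↦ σ * u + k) (Icc s t) u (1 : ℝ) = σ • (1 : ℝ) := by
    rw [fderivWithin_derivWithin, hd.hasDerivWithinAt.derivWithin hu', smul_eq_mul, mul_one]
  have h2 := (mfderivWithin 𝓘(ℝ) I γ (Icc s' t') (σ * u + k)).map_smul σ (1 : ℝ)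
  rw [← h2]
  exact congrArg (mfderivWithin 𝓘(ℝ) I γ (Icc s' t') (σ * u + k)) h1

theorem IsCausalArc.comp_add {γ : ℝ → M} {s t : ℝ} (k : ℝ) (hst : s < t)
    (h : g.IsCausalArc γ (s + k) (t + k)) : g.IsCausalArc (fun u ↦ γ (u + k)) s t := by
  have hmap : MapsTo (fun u ↦ (1 : ℝ) * u + k) (Icc s t) (Icc (s + k) (t + k)) := by
    intro u hu
    simp only [one_mul]
    exact ⟨by linarith [hu.1], by linarith [hu.2]⟩
  have heq : (fun u ↦ γ (u + k)) = γ ∘ fun u ↦ 1 * u + k := by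
    ext u
    simp
  rw [heq]
  refine ⟨h.1.comp (ContDiff.contMDiff (by fun_prop)).contMDiffOn hmap, fun u hu ↦ ?_⟩
  rw [mfderivWithin_comp_affine hst h.1 hmap hu, one_smul]
  exact h.2 _ (hmap hu)

theorem isCausalCurve_Icc {γ : ℝ → M} {a b : ℝ} {F : Set ℝ} (hF : F.Finite)
    (h : ∀ s t, a ≤ s → s < t → t ≤ b → Disjoint (Ioo s t) F → g.IsCausalArc γ s t) :
    g.IsCausalCurve γ (Icc a b) :=
  ⟨ordConnected_Icc, fun _ ha _ hb ↦ ⟨F, hF, fun s t h1 h2 h3 ↦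
    h s t (ha.1.trans h1) h2 (h3.trans hb.2)⟩⟩

theorem IsCausalCurve.mono {γ : ℝ → M} {J J' : Set ℝ} (h : g.IsCausalCurve γ J) (hJ : J' ⊆ J)
    (hJ' : J'.OrdConnected) : g.IsCausalCurve γ J' :=
  ⟨hJ', fun a ha b hb ↦ h.2 a (hJ ha) b (hJ hb)⟩

theorem IsCausalCurve.mem_causalFuture {γ : ℝ → M} {J : Set ℝ} (h : g.IsCausalCurve γ J) {a b : ℝ}
    (ha : a ∈ J) (hb : b ∈ J) (hab : a ≤ b) : γ b ∈ g.causalFuture (γ a) := by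
  rcases hab.eq_or_lt with rfl | hab
  · exact Or.inl rfl
  · exact Or.inr ⟨γ, a, b, hab, h.mono g (h.1.out ha hb) ordConnected_Icc, rfl, rfl⟩

theorem IsCausalCurve.exists_concat {γ δ : ℝ → M} {a b c d : ℝ} (hab : a < b) (hcd : c < d)
    (hγ : g.IsCausalCurve γ (Icc a b)) (hδ : g.IsCausalCurve δ (Icc c d)) (h : γ b = δ c) :
    ∃ (η : ℝ → M) (e : ℝ), b < e ∧ g.IsCausalCurve η (Icc a e) ∧ η a = γ a ∧ η b = γ b ∧
      η e = δ d := by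
  obtain ⟨F, hF, hFγ⟩ := hγ.2 a ⟨le_rfl, hab.le⟩ b ⟨hab.le, le_rfl⟩
  obtain ⟨F', hF', hFδ⟩ := hδ.2 c ⟨le_rfl, hcd.le⟩ d ⟨hcd.le, le_rfl⟩
  refine ⟨fun u ↦ if u ≤ b then γ u else δ (u + (c - b)), b + (d - c), by linarith, ?_,
    if_pos hab.le, if_pos le_rfl, ?_⟩
  · refine g.isCausalCurve_Icc (F := F ∪ {b} ∪ (fun u ↦ u - (c - b)) '' F')
      ((hF.union (finite_singleton b)).union (hF'.image _)) fun s t has hst hte hdisj ↦ ?_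
    rw [disjoint_union_right, disjoint_union_right] at hdisj
    obtain ⟨⟨h1, h2⟩, h3⟩ := hdisj
    rcases le_or_gt t b with htb | htb
    · refine IsCausalArc.congr g (hFγ s t has hst htb h1) fun u hu ↦ ?_
      exact if_pos (hu.2.trans htb)
    · have hbs : b ≤ s := by
        by_contra hbs
        exact disjoint_left.1 h2 ⟨not_le.1 hbs, htb⟩ rfl
      have harc := hFδ (s + (c - b)) (t + (c - b)) (by linarith) (by linarith) (by linarith) (by
        rw [disjoint_left] at h3 ⊢
        intro u hu huF
        exact h3 ⟨by linarith [hu.1], by linarith [hu.2]⟩ ⟨u, huF, rfl⟩)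
      refine IsCausalArc.congr g (IsCausalArc.comp_add g (c - b) hst harc) fun u hu ↦ ?_
      split_ifs with hub
      · have : u = b := le_antisymm hub (hbs.trans hu.1)
        rw [this, h]
        congr 1
        ring
      · rfl
  · dsimp only
    rw [if_neg (by linarith)]
    congr 1
    ring

theorem causalFuture_trans {p q r : M} (hpq : q ∈ g.causalFuture p) (hqr : r ∈ g.causalFuture q) :
    r ∈ g.causalFuture p := by
  rcases hpq with rfl | ⟨γ, a, b, hab, hγ, rfl, rfl⟩
  · exact hqr
  rcases hqr with rfl | ⟨δ, c, d, hcd, hδ, h, rfl⟩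
  · exact Or.inr ⟨γ, a, b, hab, hγ, rfl, rfl⟩
  obtain ⟨η, e, hbe, hη, h1, -, h3⟩ := hγ.exists_concat g hab hcd hδ h.symm
  exact Or.inr ⟨η, a, e, hab.trans hbe, hη, h1, h3⟩

theorem mem_causalFuture_self (p : M) : p ∈ g.causalFuture p := Or.inl rfl

/-- By strong causality there are no causal loops: a loop through `p` would avoid all points other
than `p`. -/
theorem causalFuture_antisymm [T1Space M] (hg : g.IsStronglyCausal) {p q : M}
    (hpq : q ∈ g.causalFuture p) (hqp : p ∈ g.causalFuture q) : p = q := by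
  by_contra hne
  rcases hpq with rfl | ⟨γ, a, b, hab, hγ, rfl, rfl⟩
  · exact hne rfl
  rcases hqp with h | ⟨δ, c, d, hcd, hδ, h, h'⟩
  · exact hne h
  obtain ⟨η, e, hbe, hη, h1, h2, h3⟩ := hγ.exists_concat g hab hcd hδ h.symm
  obtain ⟨V, hV, -, hVU⟩ := hg (γ a) {γ b}ᶜ (isOpen_compl_singleton.mem_nhds hne)
  have := hVU η a e hη (h1 ▸ mem_of_mem_nhds hV) (h3 ▸ h'.symm ▸ mem_of_mem_nhds hV)
  exact this ⟨b, ⟨hab.le, hbe.le⟩, h2⟩ rfl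

/-- A punctured left neighbourhood of the endpoint avoids the break points. -/
theorem IsCausalCurve.exists_isCausalArc_left {γ : ℝ → M} {a b : ℝ}
    (h : g.IsCausalCurve γ (Icc a b)) (hab : a < b) : ∃ s ∈ Ico a b, g.IsCausalArc γ s b := by
  obtain ⟨F, hF, hFγ⟩ := h.2 a ⟨le_rfl, hab.le⟩ b ⟨hab.le, le_rfl⟩
  have h1 : ∀ᶠ u in 𝓝[<] b, ∀ x ∈ F, x < b → x < u := by
    refine (eventually_all_finite hF).2 fun x _ ↦ ?_
    rcases lt_or_ge x b with hxb | hxb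
    · filter_upwards [Ioo_mem_nhdsLT hxb] with u hu _ using hu.1
    · exact Eventually.of_forall fun u hu ↦ absurd hu (not_lt.2 hxb)
  have h0 : ∀ᶠ u in 𝓝[<] b, u ∈ Ico a b := Ico_mem_nhdsLT hab
  obtain ⟨s, hs, hsF⟩ := (h0.and h1).exists
  refine ⟨s, hs, hFγ s b hs.1 hs.2 le_rfl ?_⟩
  rw [disjoint_left]
  exact fun u hu huF ↦ lt_asymm hu.1 (hsF u huF hu.2)

theorem IsCausalCurve.exists_isCausalArc_right {γ : ℝ → M} {a b : ℝ}
    (h : g.IsCausalCurve γ (Icc a b)) (hab : a < b) : ∃ t ∈ Ioc a b, g.IsCausalArc γ a t := by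
  obtain ⟨F, hF, hFγ⟩ := h.2 a ⟨le_rfl, hab.le⟩ b ⟨hab.le, le_rfl⟩
  have h1 : ∀ᶠ u in 𝓝[>] a, ∀ x ∈ F, a < x → u < x := by
    refine (eventually_all_finite hF).2 fun x _ ↦ ?_
    rcases lt_or_ge a x with hxb | hxb
    · filter_upwards [Ioo_mem_nhdsGT hxb] with u hu _ using hu.2
    · exact Eventually.of_forall fun u hu ↦ absurd hu (not_lt.2 hxb)
  have h0 : ∀ᶠ u in 𝓝[>] a, u ∈ Ioc a b := Ioc_mem_nhdsGT hab
  obtain ⟨s, hs, hsF⟩ := (h0.and h1).exists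
  refine ⟨s, hs, hFγ a s le_rfl hs.1 hs.2 ?_⟩
  rw [disjoint_left]
  exact fun u hu huF ↦ lt_asymm hu.2 (hsF u huF hu.1)

theorem IsCausalCurve.continuousOn {γ : ℝ → M} {J : Set ℝ} (h : g.IsCausalCurve γ J) :
    ContinuousOn γ J := by
  intro u hu
  have hJ : J = (J ∩ Iic u) ∪ (J ∩ Ici u) := by
    rw [← inter_union_distrib_left, Iic_union_Ici, inter_univ]
  rw [hJ]
  refine ContinuousWithinAt.union ?_ ?_
  · by_cases hex : ∃ a ∈ J, a < u
    · obtain ⟨a, ha, hau⟩ := hex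
      obtain ⟨s, hs, harc⟩ := IsCausalCurve.exists_isCausalArc_left g
        (h.mono g (h.1.out ha hu) ordConnected_Icc) hau
      refine (harc.1.continuousOn u ⟨hs.2.le, le_rfl⟩).mono_of_mem_nhdsWithin ?_
      filter_upwards [self_mem_nhdsWithin, mem_nhdsWithin_of_mem_nhds (Ioi_mem_nhds hs.2)]
        with x hx hx'
      exact ⟨le_of_lt hx', hx.2⟩
    · push Not at hex
      refine (continuousWithinAt_singleton (x := u)).mono fun x hx ↦ ?_
      exact le_antisymm hx.2 (hex x hx.1)
  · by_cases hex : ∃ b ∈ J, u < b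
    · obtain ⟨b, hb, hub⟩ := hex
      obtain ⟨s, hs, harc⟩ := IsCausalCurve.exists_isCausalArc_right g
        (h.mono g (h.1.out hu hb) ordConnected_Icc) hub
      refine (harc.1.continuousOn u ⟨le_rfl, hs.1.le⟩).mono_of_mem_nhdsWithin ?_
      filter_upwards [self_mem_nhdsWithin, mem_nhdsWithin_of_mem_nhds (Iio_mem_nhds hs.1)]
        with x hx hx'
      exact ⟨hx.2, le_of_lt hx'⟩
    · push Not at hex
      refine (continuousWithinAt_singleton (x := u)).mono fun x hx ↦ ?_
      exact le_antisymm (hex x hx.1) hx.2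

/-! ### Time reversal -/

/-- The spacetime with the opposite time orientation. -/
def reverse : SpacetimeStructure I M where
  metric := g.metric
  symm := g.symm
  pos_of_orthogonal := g.pos_of_orthogonal
  contMDiff_metric := g.contMDiff_metric
  timeDir x := -g.timeDir x
  metric_timeDir_neg x := by
    simpa using g.metric_timeDir_neg x
  continuous_timeDir := by
    refine continuous_iff_continuousAt.2 fun x₀ ↦ ?_
    have h0 := g.continuous_timeDir.continuousAt (x := x₀)
    rw [FiberBundle.continuousAt_totalSpace] at h0 ⊢
    refine ⟨h0.1, h0.2.neg.congr ?_⟩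
    have hb : (trivializationAt E (TangentSpace I) x₀).baseSet ∈ 𝓝 x₀ :=
      (trivializationAt E (TangentSpace I) x₀).open_baseSet.mem_nhds
        (FiberBundle.mem_baseSet_trivializationAt' x₀)
    filter_upwards [hb] with x hx
    have := ((trivializationAt E (TangentSpace I) x₀).linear ℝ hx).map_neg (g.timeDir x)
    exact this.symm

theorem isFutureCausal_reverse_neg {x : M} {v : TangentSpace I x} (h : g.IsFutureCausal x v) :
    g.reverse.IsFutureCausal x (-v) := by
  refine ⟨neg_ne_zero.2 h.1, ?_, ?_⟩
  · have : g.metric x (-v) (-v) = g.metric x v v := by simp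
    exact this.trans_le h.2.1
  · have : g.metric x (-g.timeDir x) (-v) = g.metric x (g.timeDir x) v := by simp
    exact this.trans_lt h.2.2

theorem reverse_reverse : g.reverse.reverse = g := by
  cases g
  simp [reverse]

theorem IsCausalArc.reverse {γ : ℝ → M} {s t : ℝ} (hst : s < t)
    (h : g.IsCausalArc γ (-t) (-s)) : g.reverse.IsCausalArc (fun u ↦ γ (-u)) s t := by
  have hmap : MapsTo (fun u ↦ (-1 : ℝ) * u + 0) (Icc s t) (Icc (-t) (-s)) := by
    intro u hu
    exact ⟨by linarith [hu.2], by linarith [hu.1]⟩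
  have heq : (fun u ↦ γ (-u)) = γ ∘ fun u ↦ (-1) * u + 0 := by
    ext u
    simp
  rw [heq]
  refine ⟨h.1.comp (ContDiff.contMDiff (by fun_prop)).contMDiffOn hmap, fun u hu ↦ ?_⟩
  rw [mfderivWithin_comp_affine hst h.1 hmap hu, neg_smul, one_smul]
  exact g.isFutureCausal_reverse_neg (h.2 _ (hmap hu))

theorem IsCausalCurve.reverse {γ : ℝ → M} {J : Set ℝ} (h : g.IsCausalCurve γ J) :
    g.reverse.IsCausalCurve (fun u ↦ γ (-u)) (-J) := by
  refine ⟨⟨fun x hx y hy z hz ↦ ?_⟩, fun a ha b hb ↦ ?_⟩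
  · exact h.1.out hy hx ⟨neg_le_neg hz.2, neg_le_neg hz.1⟩
  · obtain ⟨F, hF, hFγ⟩ := h.2 (-b) hb (-a) ha
    refine ⟨-F, hF.neg, fun s t has hst htb hd ↦ IsCausalArc.reverse g hst ?_⟩
    refine hFγ (-t) (-s) (by linarith) (by linarith) (by linarith) ?_
    rw [disjoint_left] at hd ⊢
    intro u hu huF
    refine hd (a := -u) ⟨by linarith [hu.2], by linarith [hu.1]⟩ (by simpa using huF)

theorem mem_causalFuture_reverse_of {p q : M} (h : q ∈ g.causalFuture p) :
    p ∈ g.reverse.causalFuture q := by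
  rcases h with rfl | ⟨γ, a, b, hab, hγ, rfl, rfl⟩
  · exact Or.inl rfl
  · refine Or.inr ⟨fun u ↦ γ (-u), -b, -a, by linarith, ?_, by simp, by simp⟩
    have := hγ.reverse
    rwa [neg_Icc] at this

theorem mem_causalFuture_reverse {p q : M} :
    p ∈ g.reverse.causalFuture q ↔ q ∈ g.causalFuture p :=
  ⟨fun h ↦ by simpa [reverse_reverse] using g.reverse.mem_causalFuture_reverse_of h,
    g.mem_causalFuture_reverse_of⟩

/-! ### Openness of causal futures and pasts -/

/-- Causal influence from an open set propagates along arcs contained in a small set. -/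
theorem exists_nhds_forall_arc [FiniteDimensional ℝ E] {ℓ : E →L[ℝ] ℝ}
    (hI : range I = {y : E | 0 ≤ ℓ y}) (hbdry : g.HasTimelikeBoundary ℓ) (x₀ : M) :
    ∃ W ∈ 𝓝 x₀, ∀ (γ : ℝ → M) (s t : ℝ), s < t → g.IsCausalArc γ s t → MapsTo γ (Icc s t) W →
      ∀ O ∈ 𝓝 (γ s), {q | ∃ p ∈ O, q ∈ g.causalFuture p} ∈ 𝓝 (γ t) := by
  have hconv : Convex ℝ (range I) := by
    rw [hI]
    exact convex_halfSpace_ge ℓ.isLinear 0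
  obtain ⟨v, r, c, C, h⟩ := g.exists_isAdapted hI hbdry x₀
  have hr := h.r_pos
  refine ⟨(extChartAt I x₀).source ∩
    (extChartAt I x₀) ⁻¹' (Metric.ball (extChartAt I x₀ x₀) (r / 2)),
    inter_mem (extChartAt_source_mem_nhds x₀)
      ((continuousAt_extChartAt x₀).preimage_mem_nhds (Metric.ball_mem_nhds _ (half_pos hr))),
    fun γ s t hst harc hmaps O hO ↦ ?_⟩
  have hsrc : MapsTo γ (Icc s t) (extChartAt I x₀).source := fun u hu ↦ (hmaps hu).1
  have hmem : MapsTo (extChartAt I x₀ ∘ γ) (Icc s t)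
      (Metric.ball (extChartAt I x₀ x₀) (r / 2) ∩ range I) := fun u hu ↦
    ⟨(hmaps hu).2, extChartAt_target_subset_range x₀ ((extChartAt I x₀).map_source (hsrc hu))⟩
  obtain ⟨hcd, hv⟩ := harc.chart g hst hsrc
  have hs : s ∈ Icc s t := ⟨le_rfl, hst.le⟩
  have ht : t ∈ Icc s t := ⟨hst.le, le_rfl⟩
  obtain ⟨ε₁, hε₁, hseg⟩ := h.exists_causalFuture_mem_nhdsWithin hconv (hmem ht)
  have hO' : ∀ᶠ κ : ℝ in 𝓝 0, (extChartAt I x₀).symm (extChartAt I x₀ (γ s) - κ • v) ∈ O := by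
    have h1 : ContinuousAt (fun κ : ℝ ↦ extChartAt I x₀ (γ s) - κ • v) 0 := by fun_prop
    have h2 : ContinuousAt (extChartAt I x₀).symm (extChartAt I x₀ (γ s) - (0 : ℝ) • v) := by
      rw [zero_smul, sub_zero]
      exact continuousAt_extChartAt_symm' (hsrc hs)
    refine ContinuousAt.comp (f := fun κ : ℝ ↦ extChartAt I x₀ (γ s) - κ • v) h2 h1 ?_
    rw [Function.comp_apply, zero_smul, sub_zero, (extChartAt I x₀).left_inv (hsrc hs)]
    exact hO
  obtain ⟨ε₂, hε₂, hball⟩ := Metric.eventually_nhds_iff.1 hO'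
  obtain ⟨κ, hκ, κ', hκ', hfut⟩ := h.exists_pushed_arc hst hcd hmem hv (lt_min hε₁ hε₂)
  have hz := hseg κ ⟨hκ.1, hκ.2.trans_le (min_le_left _ _)⟩
  have hp := hball (y := κ') (by
    rw [Real.dist_eq, sub_zero, abs_of_pos hκ'.1]
    exact hκ'.2.trans_le (min_le_right _ _))
  have hz' : ∀ᶠ x in 𝓝 (γ t), (extChartAt I x₀).symm (extChartAt I x₀ x) ∈
      g.causalFuture ((extChartAt I x₀).symm (extChartAt I x₀ (γ t) - κ • v)) := by
    have := map_extChartAt_nhds' (I := I) (hsrc ht)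
    rw [Function.comp_apply, ← this, eventually_map] at hz
    exact hz
  filter_upwards [hz', extChartAt_source_mem_nhds' (hsrc ht)] with x hx hx'
  rw [(extChartAt I x₀).left_inv hx'] at hx
  exact ⟨_, hp, g.causalFuture_trans hfut hx⟩

/-- Induction along a compact interval. -/
theorem Icc_induction {P : ℝ → Prop} {a b : ℝ} (hab : a ≤ b) (ha : P a)
    (hleft : ∀ t ∈ Ioc a b, ∃ s ∈ Ico a t, ∀ u ∈ Ico s t, P u → P t)
    (hright : ∀ t ∈ Ico a b, P t → ∃ s ∈ Ioc t b, ∀ u ∈ Ioc t s, P u) : P b := by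
  set T := {t | t ∈ Icc a b ∧ ∀ u ∈ Icc a t, P u}
  have haT : a ∈ T := ⟨⟨le_rfl, hab⟩, fun u hu ↦ le_antisymm hu.2 hu.1 ▸ ha⟩
  have hbdd : BddAbove T := ⟨b, fun t ht ↦ ht.1.2⟩
  have hle : a ≤ sSup T := le_csSup hbdd haT
  have hleb : sSup T ≤ b := csSup_le ⟨a, haT⟩ fun t ht ↦ ht.1.2
  have hlt : ∀ u ∈ Ico a (sSup T), P u := by
    intro u hu
    obtain ⟨t, ht, hut⟩ := exists_lt_of_lt_csSup ⟨a, haT⟩ hu.2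
    exact ht.2 u ⟨hu.1, hut.le⟩
  have hP : P (sSup T) := by
    rcases hle.eq_or_lt with h | h
    · rwa [← h]
    · obtain ⟨s, hs, hsP⟩ := hleft _ ⟨h, hleb⟩
      exact hsP s ⟨le_rfl, hs.2⟩ (hlt s hs)
  rcases hleb.eq_or_lt with h | h
  · rwa [← h]
  · obtain ⟨s, hs, hsP⟩ := hright _ ⟨hle, h⟩ hP
    have hsT : s ∈ T := by
      refine ⟨⟨hle.trans hs.1.le, hs.2⟩, fun u hu ↦ ?_⟩
      rcases lt_trichotomy u (sSup T) with h1 | h1 | h1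
      · exact hlt u ⟨hu.1, h1⟩
      · rwa [h1]
      · exact hsP u ⟨h1, hu.2⟩
    exact absurd (le_csSup hbdd hsT) (not_le.2 hs.1)

/-- The causal future of an open set is open. -/
theorem isOpen_causalFuture_of_isOpen [FiniteDimensional ℝ E] {ℓ : E →L[ℝ] ℝ}
    (hI : range I = {y : E | 0 ≤ ℓ y}) (hbdry : g.HasTimelikeBoundary ℓ) {O : Set M}
    (hO : IsOpen O) : IsOpen {q | ∃ p ∈ O, q ∈ g.causalFuture p} := by
  set A := {q | ∃ p ∈ O, q ∈ g.causalFuture p} with hA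
  have hOA : O ⊆ A := fun p hp ↦ ⟨p, hp, g.mem_causalFuture_self p⟩
  rw [isOpen_iff_mem_nhds]
  rintro q ⟨p, hp, rfl | ⟨γ, a, b, hab, hγ, rfl, rfl⟩⟩
  · exact mem_of_superset (hO.mem_nhds hp) hOA
  have hstep : ∀ x₀ : M, ∃ W ∈ 𝓝 x₀, ∀ s t : ℝ, s < t → g.IsCausalArc γ s t →
      MapsTo γ (Icc s t) W → A ∈ 𝓝 (γ s) → A ∈ 𝓝 (γ t) := by
    intro x₀
    obtain ⟨W, hW, hWarc⟩ := g.exists_nhds_forall_arc hI hbdry x₀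
    refine ⟨W, hW, fun s t hst harc hmaps hAs ↦
      mem_of_superset (hWarc γ s t hst harc hmaps A hAs) ?_⟩
    rintro z ⟨y, ⟨x, hx, hxy⟩, hyz⟩
    exact ⟨x, hx, g.causalFuture_trans hxy hyz⟩
  have hcont := hγ.continuousOn g
  refine Icc_induction (P := fun t ↦ A ∈ 𝓝 (γ t)) hab.le
    (mem_of_superset (hO.mem_nhds hp) hOA) (fun t ht ↦ ?_) fun t ht hAt ↦ ?_
  · obtain ⟨W, hW, hWarc⟩ := hstep (γ t)
    obtain ⟨s, hs, harc⟩ := IsCausalCurve.exists_isCausalArc_left g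
      (hγ.mono g (Icc_subset_Icc_right ht.2) ordConnected_Icc) ht.1
    have h1 := (hcont t ⟨ht.1.le, ht.2⟩).preimage_mem_nhdsWithin hW
    obtain ⟨ε, hε, hball⟩ := Metric.mem_nhdsWithin_iff.1 h1
    refine ⟨max s (t - ε / 2), ⟨hs.1.trans (le_max_left _ _), max_lt hs.2 (by linarith)⟩,
      fun u hu hAu ↦ ?_⟩
    have hsu : s ≤ u := (le_max_left _ _).trans hu.1
    have htu : t - ε / 2 ≤ u := (le_max_right _ _).trans hu.1
    refine hWarc u t hu.2 (harc.mono g hsu hu.2 le_rfl) (fun x hx ↦ hball ⟨?_, ?_⟩) hAu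
    · rw [Metric.mem_ball, Real.dist_eq, abs_lt]
      exact ⟨by linarith [hx.1], by linarith [hx.2]⟩
    · exact ⟨(hs.1.trans hsu).trans hx.1, hx.2.trans ht.2⟩
  · obtain ⟨W, hW, hWarc⟩ := hstep (γ t)
    obtain ⟨s, hs, harc⟩ := IsCausalCurve.exists_isCausalArc_right g
      (hγ.mono g (Icc_subset_Icc_left ht.1) ordConnected_Icc) ht.2
    have h1 := (hcont t ⟨ht.1, ht.2.le⟩).preimage_mem_nhdsWithin hW
    obtain ⟨ε, hε, hball⟩ := Metric.mem_nhdsWithin_iff.1 h1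
    refine ⟨min s (t + ε / 2), ⟨lt_min hs.1 (by linarith), (min_le_left _ _).trans hs.2⟩,
      fun u hu ↦ ?_⟩
    have hsu : u ≤ s := hu.2.trans (min_le_left _ _)
    have htu : u ≤ t + ε / 2 := hu.2.trans (min_le_right _ _)
    refine hWarc t u hu.1 (harc.mono g le_rfl hu.1 hsu) (fun x hx ↦ hball ⟨?_, ?_⟩) hAt
    · rw [Metric.mem_ball, Real.dist_eq, abs_lt]
      exact ⟨by linarith [hx.1], by linarith [hx.2]⟩
    · exact ⟨ht.1.trans hx.1, (hx.2.trans hsu).trans hs.2⟩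

/-- Each point lies in the interior of the causal future of points arbitrarily close to it. -/
theorem exists_causalFuture_mem_nhds [FiniteDimensional ℝ E] {ℓ : E →L[ℝ] ℝ}
    (hI : range I = {y : E | 0 ≤ ℓ y}) (hbdry : g.HasTimelikeBoundary ℓ) (x₀ : M) {U : Set M}
    (hU : U ∈ 𝓝 x₀) : ∃ p ∈ U, g.causalFuture p ∈ 𝓝 x₀ := by
  have hconv : Convex ℝ (range I) := by
    rw [hI]
    exact convex_halfSpace_ge ℓ.isLinear 0
  obtain ⟨v, r, c, C, h⟩ := g.exists_isAdapted hI hbdry x₀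
  have hr := h.r_pos
  obtain ⟨ε, hε, hseg⟩ := h.exists_causalFuture_mem_nhdsWithin hconv
    (y := extChartAt I x₀ x₀) ⟨Metric.mem_ball_self (half_pos hr), mem_range_self _⟩
  have hU' : ∀ᶠ κ : ℝ in 𝓝[>] 0, (extChartAt I x₀).symm (extChartAt I x₀ x₀ - κ • v) ∈ U := by
    apply nhdsWithin_le_nhds
    have h1 : ContinuousAt (fun κ : ℝ ↦ extChartAt I x₀ x₀ - κ • v) 0 := by fun_prop
    have h2 : ContinuousAt (extChartAt I x₀).symm (extChartAt I x₀ x₀ - (0 : ℝ) • v) := by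
      rw [zero_smul, sub_zero]
      exact continuousAt_extChartAt_symm x₀
    refine ContinuousAt.comp (f := fun κ : ℝ ↦ extChartAt I x₀ x₀ - κ • v) h2 h1 ?_
    rw [Function.comp_apply, zero_smul, sub_zero, extChartAt_to_inv]
    exact hU
  have hε' : ∀ᶠ κ : ℝ in 𝓝[>] 0, κ ∈ Ioo 0 ε := Ioo_mem_nhdsGT hε
  obtain ⟨κ, hκU, hκ⟩ := (hU'.and hε').exists
  refine ⟨_, hκU, ?_⟩
  have hz := hseg κ hκ
  rw [← map_extChartAt_nhds (I := I), eventually_map] at hz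
  filter_upwards [hz, extChartAt_source_mem_nhds (I := I) x₀] with x hx hx'
  rwa [(extChartAt I x₀).left_inv hx'] at hx

theorem isOpen_causalPast_of_isOpen [FiniteDimensional ℝ E] {ℓ : E →L[ℝ] ℝ}
    (hI : range I = {y : E | 0 ≤ ℓ y}) (hbdry : g.HasTimelikeBoundary ℓ) {O : Set M}
    (hO : IsOpen O) : IsOpen {p | ∃ q ∈ O, q ∈ g.causalFuture p} := by
  have := g.reverse.isOpen_causalFuture_of_isOpen hI hbdry hO
  simpa only [mem_causalFuture_reverse] using this

theorem exists_causalPast_mem_nhds [FiniteDimensional ℝ E] {ℓ : E →L[ℝ] ℝ}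
    (hI : range I = {y : E | 0 ≤ ℓ y}) (hbdry : g.HasTimelikeBoundary ℓ) (x₀ : M) {U : Set M}
    (hU : U ∈ 𝓝 x₀) : ∃ p ∈ U, g.causalPast p ∈ 𝓝 x₀ := by
  obtain ⟨p, hp, h⟩ := g.reverse.exists_causalFuture_mem_nhds hI hbdry x₀ hU
  refine ⟨p, hp, mem_of_superset h fun q hq ↦ ?_⟩
  exact g.mem_causalFuture_reverse.1 hq

/-! ### Consequences of global hyperbolicity -/

/-- Near `q`, the causal future of `p` is contained in a causal diamond, which is compact. -/
theorem isClosed_causalFuture [T2Space M] [FiniteDimensional ℝ E] {ℓ : E →L[ℝ] ℝ}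
    (hI : range I = {y : E | 0 ≤ ℓ y}) (hbdry : g.HasTimelikeBoundary ℓ)
    (hg : g.IsGloballyHyperbolic) (p : M) : IsClosed (g.causalFuture p) := by
  refine isClosed_of_closure_subset fun q hq ↦ ?_
  obtain ⟨q', -, hq'⟩ := g.exists_causalPast_mem_nhds hI hbdry q univ_mem
  have h1 : q ∈ closure (g.causalFuture p ∩ g.causalPast q') := by
    rw [mem_closure_iff_nhds] at hq ⊢
    intro U hU
    obtain ⟨z, hz, hz'⟩ := hq _ (inter_mem hU hq')
    exact ⟨z, hz.1, hz', hz.2⟩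
  rw [(hg.2 p q').isClosed.closure_eq] at h1
  exact h1.1

theorem isClosed_causalPast [T2Space M] [FiniteDimensional ℝ E] {ℓ : E →L[ℝ] ℝ}
    (hI : range I = {y : E | 0 ≤ ℓ y}) (hbdry : g.HasTimelikeBoundary ℓ)
    (hg : g.IsGloballyHyperbolic) (q : M) : IsClosed (g.causalPast q) := by
  refine isClosed_of_closure_subset fun p hp ↦ ?_
  obtain ⟨p', -, hp'⟩ := g.exists_causalFuture_mem_nhds hI hbdry p univ_mem
  have h1 : p ∈ closure (g.causalFuture p' ∩ g.causalPast q) := by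
    rw [mem_closure_iff_nhds] at hp ⊢
    intro U hU
    obtain ⟨z, hz, hz'⟩ := hp _ (inter_mem hU hp')
    exact ⟨z, hz.1, hz.2, hz'⟩
  rw [(hg.2 p' q).isClosed.closure_eq] at h1
  exact h1.2

/-- The causal relation is closed: let `(p, q)` be a limit of causally related pairs. If `J⁺(p')` is
a neighbourhood of `p`, then `q ∈ J⁺(p')` since `J⁺(p')` is closed; such points `p'` accumulate at
`p`, and `J⁻(q)` is closed. -/
theorem isClosed_causal_relation [T2Space M] [FiniteDimensional ℝ E] {ℓ : E →L[ℝ] ℝ}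
    (hI : range I = {y : E | 0 ≤ ℓ y}) (hbdry : g.HasTimelikeBoundary ℓ)
    (hg : g.IsGloballyHyperbolic) : IsClosed {x : M × M | x.2 ∈ g.causalFuture x.1} := by
  refine isClosed_of_closure_subset ?_
  rintro ⟨p, q⟩ hpq
  have hpast : ∀ p', g.causalFuture p' ∈ 𝓝 p → p' ∈ g.causalPast q := by
    intro p' hp'
    change q ∈ g.causalFuture p'
    rw [← (g.isClosed_causalFuture hI hbdry hg p').closure_eq, mem_closure_iff_nhds]
    intro U hU
    obtain ⟨⟨x, y⟩, hxy, hxy'⟩ := mem_closure_iff_nhds.1 hpq _ (prod_mem_nhds hp' hU)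
    exact ⟨y, hxy.2, g.causalFuture_trans hxy.1 hxy'⟩
  change p ∈ g.causalPast q
  rw [← (g.isClosed_causalPast hI hbdry hg q).closure_eq, mem_closure_iff_nhds]
  intro U hU
  obtain ⟨p', hp', hp''⟩ := g.exists_causalFuture_mem_nhds hI hbdry p hU
  exact ⟨p', hp', hpast p' hp''⟩

/-- `J⁺(p) ∩ J⁻(K)` is contained in a finite union of causal diamonds if `K` is compact. -/
theorem exists_isCompact_causalFuture_inter_past [T2Space M] [FiniteDimensional ℝ E] {ℓ : E →L[ℝ] ℝ}
    (hI : range I = {y : E | 0 ≤ ℓ y}) (hbdry : g.HasTimelikeBoundary ℓ)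
    (hg : g.IsGloballyHyperbolic) (p : M) {K : Set M} (hK : IsCompact K) :
    ∃ L, IsCompact L ∧ ∀ q ∈ g.causalFuture p, ∀ k ∈ K, k ∈ g.causalFuture q → q ∈ L := by
  choose f hf hf' using fun x ↦ g.exists_causalPast_mem_nhds hI hbdry x univ_mem
  obtain ⟨t, -, hcov⟩ := hK.elim_nhds_subcover (fun x ↦ g.causalPast (f x)) fun x _ ↦ hf' x
  refine ⟨⋃ x ∈ t, g.causalFuture p ∩ g.causalPast (f x),
    t.isCompact_biUnion fun x _ ↦ hg.2 p (f x), fun q hq k hk hkq ↦ ?_⟩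
  obtain ⟨x, hx, hkx⟩ := mem_iUnion₂.1 (hcov hk)
  exact mem_iUnion₂.2 ⟨x, hx, hq, g.causalFuture_trans hkq hkx⟩

theorem exists_isCompact_causalPast_inter_future [T2Space M] [FiniteDimensional ℝ E] {ℓ : E →L[ℝ] ℝ}
    (hI : range I = {y : E | 0 ≤ ℓ y}) (hbdry : g.HasTimelikeBoundary ℓ)
    (hg : g.IsGloballyHyperbolic) (p : M) {K : Set M} (hK : IsCompact K) :
    ∃ L, IsCompact L ∧ ∀ q ∈ g.causalPast p, ∀ k ∈ K, q ∈ g.causalFuture k → q ∈ L := by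
  choose f hf hf' using fun x ↦ g.exists_causalFuture_mem_nhds hI hbdry x univ_mem
  obtain ⟨t, -, hcov⟩ := hK.elim_nhds_subcover (fun x ↦ g.causalFuture (f x)) fun x _ ↦ hf' x
  refine ⟨⋃ x ∈ t, g.causalFuture (f x) ∩ g.causalPast p,
    t.isCompact_biUnion fun x _ ↦ hg.2 (f x) p, fun q hq k hk hkq ↦ ?_⟩
  obtain ⟨x, hx, hkx⟩ := mem_iUnion₂.1 (hcov hk)
  exact mem_iUnion₂.2 ⟨x, hx, g.causalFuture_trans hkx hkq, hq⟩

/-- An inextendible causal curve eventually leaves every compact set: by strong causality, a causal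
curve that keeps returning to each neighbourhood of a point has this point as its endpoint. -/
theorem IsCausalCurve.eventually_notMem_future {γ : ℝ → M} {J : Set ℝ} (hg : g.IsStronglyCausal)
    (hγ : g.IsCausalCurve γ J) (hJ : J.Nonempty) (hend : ∀ x, ¬ IsFutureEndpoint γ J x)
    {K : Set M} (hK : IsCompact K) : ∃ t₀ ∈ J, ∀ t ∈ J, t₀ ≤ t → γ t ∉ K := by
  refine hK.induction_on (p := fun K ↦ ∃ t₀ ∈ J, ∀ t ∈ J, t₀ ≤ t → γ t ∉ K) ?_ ?_ ?_ ?_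
  · exact ⟨hJ.some, hJ.some_mem, fun _ _ _ h ↦ h⟩
  · rintro s t hst ⟨t₀, ht₀, h⟩
    exact ⟨t₀, ht₀, fun u hu hu' hus ↦ h u hu hu' (hst hus)⟩
  · rintro s t ⟨t₀, ht₀, h⟩ ⟨t₁, ht₁, h'⟩
    refine ⟨max t₀ t₁, by rcases max_choice t₀ t₁ with e | e <;> rwa [e], fun u hu hu' hus ↦ ?_⟩
    rcases hus with hus | hus
    · exact h u hu ((le_max_left _ _).trans hu') hus
    · exact h' u hu ((le_max_right _ _).trans hu') hus
  · intro x _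
    have hx := hend x
    simp only [IsFutureEndpoint] at hx
    push Not at hx
    obtain ⟨U, hU, hUt⟩ := hx
    obtain ⟨V, hV, -, hVU⟩ := hg x U hU
    refine ⟨V, mem_nhdsWithin_of_mem_nhds hV, ?_⟩
    by_cases hex : ∃ t₁ ∈ J, γ t₁ ∈ V
    · obtain ⟨t₁, ht₁, ht₁V⟩ := hex
      obtain ⟨t₂, ht₂, ht₁₂, ht₂U⟩ := hUt t₁ ht₁
      refine ⟨t₂, ht₂, fun u hu hu' huV ↦ ht₂U ?_⟩
      exact hVU γ t₁ u (hγ.mono g (hγ.1.out ht₁ hu) ordConnected_Icc) ht₁V huV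
        ⟨t₂, ⟨ht₁₂, hu'⟩, rfl⟩
    · push Not at hex
      exact ⟨hJ.some, hJ.some_mem, fun t ht _ ↦ hex t ht⟩

theorem isStronglyCausal_reverse (hg : g.IsStronglyCausal) : g.reverse.IsStronglyCausal := by
  intro x U hU
  obtain ⟨V, hV, hVU, h⟩ := hg x U hU
  refine ⟨V, hV, hVU, fun γ a b hγ ha hb ↦ ?_⟩
  have h1 := hγ.reverse
  rw [reverse_reverse, neg_Icc] at h1
  have h2 := h _ _ _ h1 (by simpa using hb) (by simpa using ha)
  rintro _ ⟨u, hu, rfl⟩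
  exact h2 ⟨-u, ⟨neg_le_neg hu.2, neg_le_neg hu.1⟩, by simp⟩

theorem IsCausalCurve.eventually_notMem_past {γ : ℝ → M} {J : Set ℝ} (hg : g.IsStronglyCausal)
    (hγ : g.IsCausalCurve γ J) (hJ : J.Nonempty) (hend : ∀ x, ¬ IsPastEndpoint γ J x)
    {K : Set M} (hK : IsCompact K) : ∃ t₀ ∈ J, ∀ t ∈ J, t ≤ t₀ → γ t ∉ K := by
  have hend' : ∀ x, ¬ IsFutureEndpoint (fun u ↦ γ (-u)) (-J) x := by
    intro x hx
    refine hend x fun U hU ↦ ?_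
    obtain ⟨t₀, ht₀, h⟩ := hx U hU
    refine ⟨-t₀, ht₀, fun t ht htt ↦ ?_⟩
    simpa using h (-t) (by simpa using ht) (by linarith)
  obtain ⟨t₀, ht₀, h⟩ := IsCausalCurve.eventually_notMem_future g.reverse
    (g.isStronglyCausal_reverse hg) hγ.reverse hJ.neg hend' hK
  refine ⟨-t₀, ht₀, fun t ht htt ↦ ?_⟩
  simpa using h (-t) (by simpa using ht) (by linarith)

end SpacetimeStructure

/-! ### Monotone functions on ordered spaces -/

section Order

variable {X : Type*} [TopologicalSpace X]

/-- Nonnegative continuous functions that vanish at infinity. -/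
structure IsVanishing (u : X → ℝ) : Prop where
  continuous : Continuous u
  nonneg : ∀ x, 0 ≤ u x
  isCompact : ∀ c > 0, IsCompact {x | c ≤ u x}

theorem IsVanishing.bddAbove {u : X → ℝ} (hu : IsVanishing u) : BddAbove (range u) := by
  obtain ⟨B, hB⟩ := (hu.isCompact 1 one_pos).bddAbove_image hu.continuous.continuousOn
  refine ⟨max B 1, ?_⟩
  rintro _ ⟨x, rfl⟩
  rcases le_or_gt 1 (u x) with h | h
  · exact (hB ⟨x, h, rfl⟩).trans (le_max_left _ _)
  · exact h.le.trans (le_max_right _ _)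

theorem exists_isVanishing_bump [T2Space X] [LocallyCompactSpace X] {K F : Set X}
    (hK : IsCompact K) (hF : IsClosed F) (hd : Disjoint K F) :
    ∃ u : X → ℝ, IsVanishing u ∧ EqOn u 1 K ∧ EqOn u 0 F ∧ (∀ x, u x ≤ 1) ∧
      HasCompactSupport u := by
  obtain ⟨f, h1, h0, hc, h01⟩ := exists_continuous_one_zero_of_isCompact hK hF hd
  refine ⟨f, ⟨f.continuous, fun x ↦ (h01 x).1, fun c hc0 ↦ ?_⟩, h1, h0, fun x ↦ (h01 x).2, hc⟩
  refine hc.of_isClosed_subset (isClosed_le continuous_const f.continuous) fun x hx ↦ ?_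
  refine subset_tsupport _ (Function.mem_support.2 ?_)
  exact (hc0.trans_le hx).ne'

theorem exists_isVanishing_pos [T2Space X] [LocallyCompactSpace X] [SigmaCompactSpace X] :
    ∃ u : X → ℝ, IsVanishing u ∧ ∀ x, 0 < u x := by
  let K : CompactExhaustion X := default
  choose φ hφ h1 _ hle hc using fun n ↦
    exists_isVanishing_bump (K.isCompact n) isClosed_empty (disjoint_empty (K n))
  have hw : Summable fun n : ℕ ↦ (1 / 2 : ℝ) ^ n := summable_geometric_two
  have hbd : ∀ n x, ‖(1 / 2 : ℝ) ^ n * φ n x‖ ≤ (1 / 2 : ℝ) ^ n := by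
    intro n x
    rw [Real.norm_of_nonneg (mul_nonneg (by positivity) ((hφ n).nonneg x))]
    exact mul_le_of_le_one_right (by positivity) (hle n x)
  have hsum : ∀ x, Summable fun n ↦ (1 / 2 : ℝ) ^ n * φ n x :=
    fun x ↦ Summable.of_norm_bounded hw fun n ↦ hbd n x
  have hnn : ∀ n x, 0 ≤ (1 / 2 : ℝ) ^ n * φ n x :=
    fun n x ↦ mul_nonneg (by positivity) ((hφ n).nonneg x)
  have hcont : Continuous fun x ↦ ∑' n, (1 / 2 : ℝ) ^ n * φ n x :=
    continuous_tsum (fun n ↦ (hφ n).continuous.const_mul _) hw hbd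
  refine ⟨fun x ↦ ∑' n, (1 / 2 : ℝ) ^ n * φ n x, ⟨hcont, fun x ↦ tsum_nonneg fun n ↦ hnn n x,
    fun c hc0 ↦ ?_⟩, fun x ↦ ?_⟩
  · obtain ⟨N, hN⟩ := ((tendsto_sum_nat_add fun n : ℕ ↦ (1 / 2 : ℝ) ^ n).eventually_lt_const
      hc0).exists
    refine ((Finset.range N).isCompact_biUnion fun n _ ↦ (hc n).isCompact).of_isClosed_subset
      (isClosed_le continuous_const hcont) fun x hx ↦ ?_
    by_contra hxN
    simp only [mem_iUnion, not_exists] at hxN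
    -- outside the supports of the first `N` bump functions, `u` is a tail of the series
    have hz : ∑ n ∈ Finset.range N, (1 / 2 : ℝ) ^ n * φ n x = 0 :=
      Finset.sum_eq_zero fun n hn ↦ by rw [image_eq_zero_of_notMem_tsupport (hxN n hn), mul_zero]
    have h2 := (hsum x).sum_add_tsum_nat_add N
    rw [hz, zero_add] at h2
    have h3 : ∑' n, (1 / 2 : ℝ) ^ (n + N) * φ (n + N) x ≤ ∑' n, (1 / 2 : ℝ) ^ (n + N) :=
      ((summable_nat_add_iff N).2 (hsum x)).tsum_le_tsum
        (fun n ↦ (Real.le_norm_self _).trans (hbd (n + N) x)) ((summable_nat_add_iff N).2 hw)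
    have hx' : c ≤ ∑' n, (1 / 2 : ℝ) ^ n * φ n x := hx
    linarith
  · obtain ⟨n, hn⟩ := K.exists_mem x
    refine (hsum x).tsum_pos (fun n ↦ hnn n x) n ?_
    rw [h1 n hn, Pi.one_apply, mul_one]
    positivity

variable [PartialOrder X]

/-- The supremum of `u` over all points below `p`. -/
def supBelow (u : X → ℝ) (p : X) : ℝ := sSup (u '' Iic p)

namespace IsVanishing

variable {u : X → ℝ} (hu : IsVanishing u)
include hu

theorem lt_supBelow_iff {p : X} {c : ℝ} : c < supBelow u p ↔ ∃ x ≤ p, c < u x := by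
  rw [supBelow, lt_csSup_iff (hu.bddAbove.mono (image_subset_range _ _)) (nonempty_Iic.image _)]
  simp [mem_image]

theorem supBelow_le {p : X} {c : ℝ} (h : ∀ x ≤ p, u x ≤ c) : supBelow u p ≤ c := by
  by_contra hc
  obtain ⟨x, hx, hx'⟩ := hu.lt_supBelow_iff.1 (not_le.1 hc)
  exact (h x hx).not_gt hx'

theorem le_supBelow {p x : X} (h : x ≤ p) : u x ≤ supBelow u p :=
  le_csSup (hu.bddAbove.mono (image_subset_range _ _)) ⟨x, h, rfl⟩

theorem supBelow_nonneg (p : X) : 0 ≤ supBelow u p := (hu.nonneg p).trans (hu.le_supBelow le_rfl)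

theorem monotone_supBelow : Monotone (supBelow u) := fun _ _ h ↦
  hu.supBelow_le fun _ hx ↦ hu.le_supBelow (hx.trans h)

/-- Lower semicontinuity holds since up-closures of open sets are open, upper semicontinuity since
up-closures of compact sets are closed. -/
theorem continuous_supBelow [OrderClosedTopology X] [HasUpperLowerClosure X] :
    Continuous (supBelow u) := by
  refine continuous_iff_continuousAt.2 fun p ↦ tendsto_order.2 ⟨fun c hc ↦ ?_, fun c hc ↦ ?_⟩
  · obtain ⟨x, hx, hxc⟩ := hu.lt_supBelow_iff.1 hc
    have ho : IsOpen (upperClosure {x | c < u x} : Set X) :=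
      (isOpen_lt continuous_const hu.continuous).upperClosure
    filter_upwards [ho.mem_nhds (mem_upperClosure.2 ⟨x, hxc, hx⟩)] with q hq
    obtain ⟨y, hy, hyq⟩ := mem_upperClosure.1 hq
    exact hu.lt_supBelow_iff.2 ⟨y, hyq, hy⟩
  · obtain ⟨c', hc', hcc'⟩ := exists_between hc
    have hpos : 0 < c' := (hu.supBelow_nonneg p).trans_lt hc'
    have : ∀ᶠ q in 𝓝 p, ∀ x ∈ {x | c' ≤ u x}, ¬ x ≤ q := by
      refine (hu.isCompact c' hpos).eventually_forall_of_forall_eventually fun x hx ↦ ?_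
      have hcl : IsClosed {z : X × X | z.2 ≤ z.1} := isClosed_le continuous_snd continuous_fst
      refine hcl.isOpen_compl.mem_nhds fun hxp ↦ ?_
      exact ((hu.le_supBelow hxp).trans_lt hc').not_ge hx
    filter_upwards [this] with q hq
    refine (hu.supBelow_le fun x hx ↦ ?_).trans_lt hcc'
    by_contra hxc
    exact hq x (not_le.1 hxc).le hx

end IsVanishing

variable [OrderClosedTopology X] [HasUpperLowerClosure X] [LocallyCompactSpace X]

theorem exists_monotone_separating {x y : X} (h : ¬ x ≤ y) :
    ∃ f : X → ℝ, Continuous f ∧ Monotone f ∧ (∀ p, f p ∈ Icc (0 : ℝ) 1) ∧ f x = 1 ∧ f y = 0 := by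
  obtain ⟨u, hu, h1, h0, hle, -⟩ := exists_isVanishing_bump (isCompact_singleton (x := x))
    (isClosed_Iic (a := y)) (disjoint_singleton_left.2 h)
  have hle' : ∀ p, supBelow u p ≤ 1 := fun p ↦ hu.supBelow_le fun x _ ↦ hle x
  refine ⟨supBelow u, hu.continuous_supBelow, hu.monotone_supBelow,
    fun p ↦ ⟨hu.supBelow_nonneg p, hle' p⟩, (hle' x).antisymm ?_,
    (hu.supBelow_le fun z hz ↦ (h0 hz).le).antisymm (hu.supBelow_nonneg y)⟩
  exact (h1 rfl).ge.trans (hu.le_supBelow le_rfl)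

/-- By second countability, countably many monotone functions suffice to separate all pairs of
points; their weighted sum is strictly monotone. -/
theorem exists_strictMono [SecondCountableTopology X] :
    ∃ s : X → ℝ, Continuous s ∧ StrictMono s ∧ ∀ p, s p ∈ Icc (0 : ℝ) 1 := by
  choose f hf hmono h01 hf1 hf0 using fun z : {z : X × X // ¬ z.1 ≤ z.2} ↦
    exists_monotone_separating z.2
  obtain ⟨T, hT, hTU⟩ := TopologicalSpace.isOpen_iUnion_countable
    (fun z ↦ {q : X × X | f z q.2 < f z q.1}) fun z ↦
      isOpen_lt ((hf z).comp continuous_snd) ((hf z).comp continuous_fst)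
  obtain ⟨w, hw, c, hwc, hc⟩ := hT.exists_pos_hasSum_le one_pos
  have hnn : ∀ (z : T) p, 0 ≤ w z * f z p := fun z p ↦ mul_nonneg (hw z).le (h01 z p).1
  have hle : ∀ (z : T) p, w z * f z p ≤ w z := fun z p ↦
    mul_le_of_le_one_right (hw z).le (h01 z p).2
  have hbd : ∀ (z : T) p, ‖w z * f z p‖ ≤ w z := fun z p ↦ by
    rw [Real.norm_of_nonneg (hnn z p)]
    exact hle z p
  have hsum : ∀ p, Summable fun z : T ↦ w z * f z p :=
    fun p ↦ Summable.of_norm_bounded hwc.summable fun z ↦ hbd z p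
  refine ⟨fun p ↦ ∑' z : T, w z * f z p,
    continuous_tsum (fun z ↦ (hf z).const_mul _) hwc.summable hbd, fun p q hpq ↦ ?_,
    fun p ↦ ⟨tsum_nonneg fun z ↦ hnn z p, ?_⟩⟩
  · have hmem : (q, p) ∈ ⋃ z, {q : X × X | f z q.2 < f z q.1} := by
      refine mem_iUnion.2 ⟨⟨(q, p), hpq.not_ge⟩, ?_⟩
      rw [mem_ofPred_eq, hf1 ⟨(q, p), hpq.not_ge⟩, hf0 ⟨(q, p), hpq.not_ge⟩]
      exact one_pos
    rw [← hTU] at hmem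
    obtain ⟨z, hz, hzpq⟩ := mem_iUnion₂.1 hmem
    exact (hsum p).tsum_lt_tsum (i := ⟨z, hz⟩)
      (fun z ↦ mul_le_mul_of_nonneg_left (hmono z hpq.le) (hw z).le)
      (mul_lt_mul_of_pos_left hzpq (hw z)) (hsum q)
  · exact ((hsum p).tsum_le_tsum (fun z ↦ hle z p) hwc.summable).trans (hwc.tsum_eq.le.trans hc)

/-- On a compact antichain, every continuous function is approximated by monotone ones: these form a
lattice of functions, and they take prescribed values at any two points of the antichain. -/
theorem exists_monotone_approx {R : Set X} [CompactSpace R] (hanti : IsAntichain (· ≤ ·) R)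
    (F : C(R, ℝ)) {δ : ℝ} (hδ : 0 < δ) (hF : ‖F‖ ≤ δ) :
    ∃ h : C(X, ℝ), Monotone h ∧ (∀ p, |h p| ≤ δ) ∧ ‖F - h.restrict R‖ ≤ δ / 2 := by
  set L : Set C(R, ℝ) := {G | ∃ h : C(X, ℝ), Monotone h ∧ h.restrict R = G} with hL
  have hsep : L.SeparatesPointsStrongly := by
    -- for `a ≤ b`, a monotone function with value `a` at `x` and `b` at `y`
    have key : ∀ (x y : R) (a b : ℝ), x ≠ y → a ≤ b →
        ∃ h : C(X, ℝ), Monotone h ∧ h x = a ∧ h y = b := by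
      intro x y a b hxy hab
      have hyx : ¬ (y : X) ≤ x := hanti y.2 x.2 fun h ↦ hxy (Subtype.ext h.symm)
      obtain ⟨f, hf, hmono, -, h1, h0⟩ := exists_monotone_separating hyx
      refine ⟨⟨fun p ↦ a + (b - a) * f p, by fun_prop⟩, fun p q hpq ↦ ?_, ?_, ?_⟩
      · have := mul_le_mul_of_nonneg_left (hmono hpq) (sub_nonneg.2 hab)
        simpa using this
      · simp [h0]
      · simp [h1]
    intro v x y
    rcases eq_or_ne x y with rfl | hxy
    · exact ⟨_, ⟨.const X (v x), monotone_const, rfl⟩, rfl, rfl⟩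
    rcases le_total (v x) (v y) with h | h
    · obtain ⟨k, hk, h1, h2⟩ := key x y _ _ hxy h
      exact ⟨_, ⟨k, hk, rfl⟩, h1, h2⟩
    · obtain ⟨k, hk, h1, h2⟩ := key y x _ _ hxy.symm h
      exact ⟨_, ⟨k, hk, rfl⟩, h2, h1⟩
  have hcl := ContinuousMap.sublattice_closure_eq_top L
    ⟨_, .const X 0, monotone_const, rfl⟩
    (by
      rintro _ ⟨h, hh, rfl⟩ _ ⟨k, hk, rfl⟩
      exact ⟨h ⊓ k, fun p q hpq ↦ inf_le_inf (hh hpq) (hk hpq), rfl⟩)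
    (by
      rintro _ ⟨h, hh, rfl⟩ _ ⟨k, hk, rfl⟩
      exact ⟨h ⊔ k, fun p q hpq ↦ sup_le_sup (hh hpq) (hk hpq), rfl⟩) hsep
  have hFcl : F ∈ closure L := hcl ▸ mem_univ F
  obtain ⟨_, ⟨h, hh, rfl⟩, hdist⟩ := Metric.mem_closure_iff.1 hFcl (δ / 2) (half_pos hδ)
  -- truncation to `[-δ, δ]` keeps monotonicity and does not increase the distance to `F`
  refine ⟨⟨fun p ↦ max (-δ) (min δ (h p)), by fun_prop⟩, fun p q hpq ↦
    max_le_max le_rfl (min_le_min le_rfl (hh hpq)), fun p ↦ abs_le.2 ⟨le_max_left _ _, ?_⟩, ?_⟩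
  · exact max_le (by linarith) (min_le_left _ _)
  · rw [ContinuousMap.norm_le _ (half_pos hδ).le]
    intro r
    have h1 : |F r| ≤ δ := (F.norm_coe_le_norm r).trans hF
    have h2 : |F r - h r| ≤ δ / 2 := by
      have := (ContinuousMap.dist_apply_le_dist (f := F) (g := h.restrict R) r).trans hdist.le
      rwa [Real.dist_eq] at this
    rw [abs_le] at h1 h2
    simp only [ContinuousMap.sub_apply, ContinuousMap.restrict_apply, ContinuousMap.coe_mk,
      Real.norm_eq_abs, abs_le]
    rcases max_cases (-δ) (min δ (h r)) with ⟨e, _⟩ | ⟨e, _⟩ <;>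
    rcases min_cases δ (h r) with ⟨e', _⟩ | ⟨e', _⟩ <;> rw [e] <;>
    constructor <;> linarith

/-- Exact extension by summing successive approximations of the remainders, which decrease
geometrically. -/
theorem exists_monotone_extension {R : Set X} (hR : IsCompact R) (hanti : IsAntichain (· ≤ ·) R)
    (F : C(R, ℝ)) :
    ∃ (e : X → ℝ) (B : ℝ), Continuous e ∧ Monotone e ∧ (∀ p, |e p| ≤ B) ∧ ∀ r : R, e r = F r := by
  have := isCompact_iff_compactSpace.1 hR
  set δ : ℝ := ‖F‖ + 1
  have hδ : 0 < δ := by positivity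
  choose! h hmono hbd happrox using fun (n : ℕ) (G : C(R, ℝ)) (hG : ‖G‖ ≤ δ * (1 / 2) ^ n) ↦
    exists_monotone_approx hanti G (δ := δ * (1 / 2) ^ n) (by positivity) hG
  -- the remainders of the successive approximations
  let Φ : ℕ → C(R, ℝ) := fun n ↦ Nat.rec F (fun n G ↦ G - (h n G).restrict R) n
  have hΦ : ∀ n, ‖Φ n‖ ≤ δ * (1 / 2) ^ n := by
    intro n
    induction n with
    | zero => simp [Φ, δ]
    | succ n ih =>
      refine (happrox n (Φ n) ih).trans_eq ?_
      ring
  have hw : Summable fun n : ℕ ↦ δ * (1 / 2 : ℝ) ^ n := summable_geometric_two.mul_left δ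
  have hbd' : ∀ n p, ‖h n (Φ n) p‖ ≤ δ * (1 / 2) ^ n := fun n p ↦ hbd n (Φ n) (hΦ n) p
  have hsum : ∀ p, Summable fun n ↦ h n (Φ n) p :=
    fun p ↦ Summable.of_norm_bounded hw fun n ↦ hbd' n p
  refine ⟨fun p ↦ ∑' n, h n (Φ n) p, ∑' n : ℕ, δ * (1 / 2 : ℝ) ^ n,
    continuous_tsum (fun n ↦ (h n (Φ n)).continuous) hw hbd', fun p q hpq ↦ ?_, fun p ↦ ?_,
    fun r ↦ ?_⟩
  · exact (hsum p).tsum_le_tsum (fun n ↦ hmono n (Φ n) (hΦ n) hpq) (hsum q)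
  · exact tsum_of_norm_bounded hw.hasSum fun n ↦ hbd' n p
  · have hpart : ∀ n, ∑ k ∈ Finset.range n, h k (Φ k) r = F r - Φ n r := by
      intro n
      induction n with
      | zero => simp [Φ]
      | succ n ih =>
        have : Φ (n + 1) r = Φ n r - h n (Φ n) r := rfl
        rw [Finset.sum_range_succ, ih, this]
        ring
    refine tendsto_nhds_unique (hsum r).hasSum.tendsto_sum_nat ?_
    simp_rw [hpart]
    have h0 : Tendsto (fun n ↦ Φ n r) atTop (𝓝 0) := by
      refine squeeze_zero_norm (fun n ↦ ((Φ n).norm_coe_le_norm r).trans (hΦ n)) ?_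
      simpa using (tendsto_pow_atTop_nhds_zero_of_lt_one (by norm_num : (0 : ℝ) ≤ 1 / 2)
        (by norm_num)).const_mul δ
    simpa using h0.const_sub (F r)

/-- A strictly monotone function, vanishing on a given compact antichain, which is positive at the
points above a given point that are not below a suitable compact set, and dually. -/
theorem exists_time_function [SecondCountableTopology X] {R : Set X} (hR : IsCompact R)
    (hanti : IsAntichain (· ≤ ·) R) :
    ∃ f : X → ℝ, Continuous f ∧ StrictMono f ∧ (∀ r ∈ R, f r = 0) ∧
      (∀ a, ∃ K, IsCompact K ∧ ∀ p, a ≤ p → (∀ k ∈ K, ¬ p ≤ k) → 0 < f p) ∧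
      ∀ a, ∃ K, IsCompact K ∧ ∀ p, p ≤ a → (∀ k ∈ K, ¬ k ≤ p) → f p < 0 := by
  obtain ⟨u, hu, hpos⟩ := exists_isVanishing_pos (X := X)
  have hu' : IsVanishing (X := Xᵒᵈ) u := ⟨hu.continuous, hu.nonneg, hu.isCompact⟩
  obtain ⟨s, hs, hsmono, hs01⟩ := exists_strictMono (X := X)
  -- the supremum of `u` over the past and over the future of a point
  set α : X → ℝ := supBelow u with hα
  set β : X → ℝ := supBelow (X := Xᵒᵈ) u with hβ
  have hαc : Continuous α := hu.continuous_supBelow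
  have hβc : Continuous β := hu'.continuous_supBelow
  have hα0 : ∀ {a p : X}, a ≤ p → u a ≤ α p := hu.le_supBelow
  have hβ0 : ∀ {a p : X}, p ≤ a → u a ≤ β p := fun h ↦ hu'.le_supBelow h
  have hαpos : ∀ p, 0 < α p := fun p ↦ (hpos p).trans_le (hα0 le_rfl)
  have hβpos : ∀ p, 0 < β p := fun p ↦ (hpos p).trans_le (hβ0 le_rfl)
  have hαmono : Monotone α := hu.monotone_supBelow
  have hβanti : Antitone β := fun p q hpq ↦ hu'.monotone_supBelow hpq
  have hαle : ∀ {p c}, (∀ x ≤ p, u x ≤ c) → α p ≤ c := hu.supBelow_le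
  have hβle : ∀ {p : X} {c}, (∀ x, p ≤ x → u x ≤ c) → β p ≤ c := fun h ↦ hu'.supBelow_le h
  have hfc : Continuous fun p ↦ Real.log (α p) - Real.log (β p) + s p :=
    ((hαc.log fun p ↦ (hαpos p).ne').sub (hβc.log fun p ↦ (hβpos p).ne')).add hs
  obtain ⟨e, B, hec, hemono, heB, heR⟩ := exists_monotone_extension hR hanti
    ⟨fun r : R ↦ -(Real.log (α r) - Real.log (β r) + s r), (hfc.comp continuous_subtype_val).neg⟩
  refine ⟨fun p ↦ Real.log (α p) - Real.log (β p) + s p + e p, hfc.add hec, fun p q hpq ↦ ?_,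
    fun r hr ↦ ?_, fun a ↦ ?_, fun a ↦ ?_⟩
  · have h1 := Real.log_le_log (hαpos p) (hαmono hpq.le)
    have h2 := Real.log_le_log (hβpos q) (hβanti hpq.le)
    have h3 := hsmono hpq
    have h4 := hemono hpq.le
    dsimp only
    linarith
  · have := heR ⟨r, hr⟩
    simp only [ContinuousMap.coe_mk] at this
    dsimp only
    rw [this]
    ring
  -- where `β ≤ c`, the term `-log β` exceeds `-log (u a)` plus the bound `B` of `e`
  · set c := u a * Real.exp (-B - 1) with hc
    have hc0 : 0 < c := mul_pos (hpos a) (Real.exp_pos _)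
    refine ⟨_, hu.isCompact c hc0, fun p hap hp ↦ ?_⟩
    have hβc : β p ≤ c := hβle fun x hx ↦ by
      by_contra hxc
      exact hp x (not_le.1 hxc).le hx
    have h1 := Real.log_le_log (hpos a) (hα0 hap)
    have h2 := Real.log_le_log (hβpos p) hβc
    rw [hc, Real.log_mul (hpos a).ne' (Real.exp_pos _).ne', Real.log_exp] at h2
    have h3 := (hs01 p).1
    have h4 := (abs_le.1 (heB p)).1
    linarith
  -- where `α ≤ c`, the term `log α` outweighs `-log (u a)`, the bound `B` of `e` and `s ≤ 1`
  · set c := u a * Real.exp (-B - 2) with hc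
    have hc0 : 0 < c := mul_pos (hpos a) (Real.exp_pos _)
    refine ⟨_, hu.isCompact c hc0, fun p hpa hp ↦ ?_⟩
    have hαc : α p ≤ c := hαle fun x hx ↦ by
      by_contra hxc
      exact hp x (not_le.1 hxc).le hx
    have h1 := Real.log_le_log (hpos a) (hβ0 hpa)
    have h2 := Real.log_le_log (hαpos p) hαc
    rw [hc, Real.log_mul (hpos a).ne' (Real.exp_pos _).ne', Real.log_exp] at h2
    have h3 := (hs01 p).2
    have h4 := (abs_le.1 (heB p)).2
    linarith

end Order

end
end CausalTheory

theorem mainTheorem7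
    {E : Type*} [NormedAddCommGroup E] [NormedSpace ℝ E] [FiniteDimensional ℝ E]
    {H : Type*} [TopologicalSpace H] (I : ModelWithCorners ℝ E H)
    (ℓ : E →L[ℝ] ℝ) (hI : Set.range I = {y : E | 0 ≤ ℓ y})
    {M : Type*} [TopologicalSpace M] [ChartedSpace H M] [IsManifold I ∞ M]
    [T2Space M] [SecondCountableTopology M]
    (g : CausalTheory.SpacetimeStructure I M)
    (hbdry : g.HasTimelikeBoundary ℓ)
    (hg : g.IsGloballyHyperbolic)
    (R : Set M) (hRcompact : IsCompact R) (hRacausal : g.IsAcausal R) :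
    ∃ S : Set M, g.IsCauchySlice S ∧ R ⊆ S := by
  -- `M`, ordered by causality, satisfies the hypotheses of `exists_time_function`
  let _ : PartialOrder M :=
    { le := fun p q ↦ q ∈ g.causalFuture p
      le_refl := g.mem_causalFuture_self
      le_trans := fun _ _ _ ↦ g.causalFuture_trans
      le_antisymm := fun _ _ ↦ g.causalFuture_antisymm hg.1 }
  have : OrderClosedTopology M := ⟨g.isClosed_causal_relation hI hbdry hg⟩
  have hup : ∀ s : Set M, IsOpen s → IsOpen (upperClosure s : Set M) :=
    fun s hs ↦ g.isOpen_causalFuture_of_isOpen hI hbdry hs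
  have hlow : ∀ s : Set M, IsOpen s → IsOpen (lowerClosure s : Set M) :=
    fun s hs ↦ g.isOpen_causalPast_of_isOpen hI hbdry hs
  have : HasUpperLowerClosure M :=
    { isOpen_upperClosure := hup
      isOpen_lowerClosure := hlow
      isUpperSet_closure := fun s hs x y hxy hx ↦ mem_closure_iff.2 fun U hU hyU ↦ by
        obtain ⟨z, hz, hzs⟩ := mem_closure_iff.1 hx _ (hlow U hU) (mem_lowerClosure.2 ⟨y, hyU, hxy⟩)
        obtain ⟨w, hw, hzw⟩ := mem_lowerClosure.1 hz
        exact ⟨w, hw, hs hzw hzs⟩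
      isLowerSet_closure := fun s hs x y hxy hx ↦ mem_closure_iff.2 fun U hU hyU ↦ by
        obtain ⟨z, hz, hzs⟩ := mem_closure_iff.1 hx _ (hup U hU) (mem_upperClosure.2 ⟨y, hyU, hxy⟩)
        obtain ⟨w, hw, hwz⟩ := mem_upperClosure.1 hz
        exact ⟨w, hw, hs hwz hzs⟩ }
  have : LocallyCompactSpace M := Manifold.locallyCompact_of_finiteDimensional I
  obtain ⟨f, hf, hfmono, hfR, hfpos, hfneg⟩ := CausalTheory.exists_time_function hRcompact
    (fun p hp q hq hne hle ↦ hne (hRacausal p hp q hq hle))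
  refine ⟨f ⁻¹' {0}, ⟨isClosed_singleton.preimage hf, fun p hp q hq hpq ↦ ?_, ?_⟩, hfR⟩
  · by_contra hne
    have h1 := hfmono (lt_of_le_of_ne (show p ≤ q from hpq) hne)
    rw [show f p = 0 from hp, show f q = 0 from hq] at h1
    exact lt_irrefl _ h1
  · refine eq_univ_of_forall fun p γ J ⟨hJ, hγ, hfut, hpast⟩ _ ↦ ?_
    obtain ⟨t, ht⟩ := hJ
    -- towards the future the curve leaves the compact set of points between `γ t` and `K`
    obtain ⟨t₁, ht₁, h₁⟩ : ∃ t₁ ∈ J, 0 < f (γ t₁) := by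
      obtain ⟨K, hK, hKf⟩ := hfpos (γ t)
      obtain ⟨L, hL, hL'⟩ := g.exists_isCompact_causalFuture_inter_past hI hbdry hg (γ t) hK
      obtain ⟨t₀, ht₀, h⟩ := hγ.eventually_notMem_future g hg.1 ⟨t, ht⟩ hfut hL
      have hmax : max t t₀ ∈ J := by rcases max_choice t t₀ with e | e <;> rwa [e]
      have hle := hγ.mem_causalFuture g ht hmax (le_max_left _ _)
      exact ⟨max t t₀, hmax, hKf _ hle fun k hk hkl ↦
        h _ hmax (le_max_right _ _) (hL' _ hle k hk hkl)⟩
    obtain ⟨t₂, ht₂, h₂⟩ : ∃ t₂ ∈ J, f (γ t₂) < 0 := by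
      obtain ⟨K, hK, hKf⟩ := hfneg (γ t)
      obtain ⟨L, hL, hL'⟩ := g.exists_isCompact_causalPast_inter_future hI hbdry hg (γ t) hK
      obtain ⟨t₀, ht₀, h⟩ := hγ.eventually_notMem_past g hg.1 ⟨t, ht⟩ hpast hL
      have hmin : min t t₀ ∈ J := by rcases min_choice t t₀ with e | e <;> rwa [e]
      have hle := hγ.mem_causalFuture g hmin ht (min_le_left _ _)
      exact ⟨min t t₀, hmin, hKf _ hle fun k hk hkl ↦
        h _ hmin (min_le_right _ _) (hL' _ hle k hk hkl)⟩
    obtain ⟨t₃, ht₃, h₃⟩ := hγ.1.isPreconnected.intermediate_value ht₂ ht₁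
      (hf.comp_continuousOn (hγ.continuousOn g)) ⟨h₂.le, h₁.le⟩
    exact ⟨γ t₃, ⟨t₃, ht₃, rfl⟩, h₃⟩
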